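/- Composition is written diagrammatically: for $f:X\to Y$ and $g:Y\to Z$ the composite is $f\circ g:X\to Z$. **Universe categories.** A *universe category* $({\cal C},p,pt)$ is a category ${\cal C}$ with a chosen final object $pt$, a morphism $p:\widetilde U\to U$, and, for every $F:X\to U$, a chosen pull-back square with vertex $(X;F)$ and projections $p_{X,F}:(X;F)\to X$, $Q(F):(X;F)\to\widetilde U$, so that $Q(F)\circ p=p_{X,F}\circ F$. For $f:X'\to X$ let $Q(f,F):(X';f\circ F)\to(X;F)$ be the morphism with $Q(f,F)\circ p_{X,F}=p_{X',f\circ F}\circ f$ and $Q(f,F)\circ Q(F)=Q(f\circ F)$. Put $$D_p(X,V)=\{(F_1,F_2)\mid F_1:X\to U,\ F_2:(X;F_1)\to V\},$$ which is functorial by $D_p(f,V)(F_1,F_2)=(f\circ F_1,\,Q(f,F_1)\circ F_2)$ and $D_p(X,g)(F_1,F_2)=(F_1,F_2\circ g)$. A *locally cartesian closed* structure on ${\cal C}$ consists of chosen fiber products $(X,f)\times_Z(Y,g)$ of all pairs of morphisms with a common codomain, and, for all $f:X\to Z$, $g:Y\to Z$, a chosen object $\underline{Hom}_Z((X,f),(Y,g))$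 over $Z$, functorial in $(Y,g)$, with evaluation morphisms $ev:\underline{Hom}_Z((X,f),(Y,g))\times_Z(X,f)\to (Y,g)$ over $Z$, natural in $(Y,g)$, such that for every $h:W\to Z$ the map $u\mapsto (u\times Id_X)\circ ev$ is a bijection from the morphisms $(W,h)\to\underline{Hom}_Z((X,f),(Y,g))$ over $Z$ to the morphisms $(W,h)\times_Z(X,f)\to(Y,g)$ over $Z$. If ${\cal C}$ is a universe category with such a structure, then $U\times V$ denotes the chosen fiber product over $pt$, and $I_p(V)=\underline{Hom}_U((\widetilde U,p),(U\times V,pr_1))$, with its morphism $prI_p(V):I_p(V)\to U$; it is functorial in $V$, with $I_p(f)$ induced by $Id_U\times f$. Let $st_p(V):(I_p(V);prI_p(V))\to V$ be the composite of the canonical isomorphism $(I_p(V);prI_p(V))\cong (I_p(V),prI_p(V))\times_U(\widetilde U,p)$, the evaluation morphism and $pr_2:U\times V\to V$. The map $\eta^{!}:Hom(X,I_p(V))\to D_p(X,V)$, $g\mapsto (g\circ prI_p(V),\,Q(g,prI_p(V))\circ st_p(V))$ is a bijection; $\eta:D_p(X,V)\to Hom(X,I_p(V))$ is its inverse. A *$\Pi$-structure*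 on $p$ is a pair $(\widetilde P,P)$ of morphisms $\widetilde P:I_p(\widetilde U)\to\widetilde U$, $P:I_p(U)\to U$ such that the square with sides $\widetilde P$, $p$, $I_p(p)$, $P$ (so that $\widetilde P\circ p=I_p(p)\circ P$) is a pull-back square. **C-systems.** A *C-system* is a category with a length function $l:Ob\to\mathbb N$, a final object $pt$, which is the only object of length $0$, a map $ft:Ob\to Ob$ with $ft(pt)=pt$ and $l(ft(X))=l(X)-1$ if $l(X)>0$, morphisms $p_X:X\to ft(X)$, and, for $l(X)>0$ and $f:Y\to ft(X)$, an object $f^*(X)$ of positive length with $ft(f^*(X))=Y$ and a morphism $q(f,X):f^*(X)\to X$ which form a pull-back square with $p_{f^*(X)}$, $p_X$, $f$ and are strictly functorial in $f$. A *homomorphism of C-systems* is a functor strictly preserving all this structure. $Ob_n(\Gamma)$ is the set of $\Delta$ with $l(\Delta)\ge n+l(\Gamma)$ and $ft^n(\Delta)=\Gamma$; $\widetilde{Ob}_n(\Gamma)$ is the set of sections $s:ft(\Delta)\to\Delta$ of $p_\Delta$ with $\Delta\in Ob_n(\Gamma)$ and $l(\Delta)>0$, and $\partial(s)=\Delta$.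 For $f:\Gamma'\to\Gamma$, iterated canonical pull-back gives $f^*:Ob_n(\Gamma)\to Ob_n(\Gamma')$ and $f^*:\widetilde{Ob}_n(\Gamma)\to\widetilde{Ob}_n(\Gamma')$ ($n\geq 1$). A *$(\Pi,\lambda)$-structure* consists of functions $\Pi_\Gamma:Ob_2(\Gamma)\to Ob_1(\Gamma)$ and $\lambda_\Gamma:\widetilde{Ob}_2(\Gamma)\to\widetilde{Ob}_1(\Gamma)$ for all $\Gamma$, commuting with all $f^*$, such that $\partial(\lambda_\Gamma(s))=\Pi_\Gamma(\partial(s))$ and this commutative square of sets is a pull-back square for every $\Gamma$. A homomorphism of C-systems $H$ *is a homomorphism of C-systems with $(\Pi,\lambda)$-structures* $(\Pi,\lambda)$, $(\Pi',\lambda')$ if $H(\Pi_\Gamma(T))=\Pi'_{H(\Gamma)}(H(T))$ and $H(\lambda_\Gamma(s))=\lambda'_{H(\Gamma)}(H(s))$ for all $\Gamma$, $T\in Ob_2(\Gamma)$, $s\in\widetilde{Ob}_2(\Gamma)$. **The C-system $CC({\cal C},p)$.** Its objects are pairs $(n,A)$ with $A\in Ob_n$, where $Ob_0$ has one element, $int$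 of which is $pt$, and $Ob_{n+1}$ is the set of pairs $(A,F)$ with $A\in Ob_n$, $F:int(A)\to U$, and $int(A,F)=(int(A);F)$. The morphisms $X\to Y$ are the morphisms $int(X)\to int(Y)$ of ${\cal C}$. Further $l(n,A)=n$, $ft(n+1,(A,F))=(n,A)$, the projection of $(n+1,(A,F))$ is $p_{int(A),F}$, and for $f:(m,B)\to(n,A)$ one has $f^*(n+1,(A,F))=(m+1,(B,int(f)\circ F))$ with canonical morphism $Q(int(f),F)$. For $\Gamma=(n,A)$ there are bijections $$u_1:Ob_1(\Gamma)\to Hom(int(\Gamma),U),\qquad u_2:Ob_2(\Gamma)\to D_p(int(\Gamma),U),$$ $$\widetilde u_1:\widetilde{Ob}_1(\Gamma)\to Hom(int(\Gamma),\widetilde U),\qquad \widetilde u_2:\widetilde{Ob}_2(\Gamma)\to D_p(int(\Gamma),\widetilde U)$$ given by $u_1(n+1,(A,F))=F$, $u_2(n+2,((A,F_1),F_2))=(F_1,F_2)$, $\widetilde u_1(s)=int(s)\circ Q(u_1(\partial(s)))$ and $\widetilde u_2(s)=(u_1(ft(\partial(s))),\,\widetilde u_1(s))$, where in the last pair $s$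 is regarded as an element of $\widetilde{Ob}_1(ft(\partial(s)))$. If ${\cal C}$ is locally cartesian closed and $(\widetilde P,P)$ is a $\Pi$-structure on $p$, then $$\Pi_\Gamma(T)=u_1^{-1}(\eta(u_2(T))\circ P),\qquad \lambda_\Gamma(s)=\widetilde u_1^{-1}(\eta(\widetilde u_2(s))\circ\widetilde P)$$ is a $(\Pi,\lambda)$-structure on $CC({\cal C},p)$, called the one defined by $(\widetilde P,P)$. **Universe category functors.** A *universe category functor* ${\bf\Phi}=(\Phi,\phi,\widetilde\phi)$ from $({\cal C},p,pt)$ to $({\cal C}',p',pt')$ is a functor $\Phi:{\cal C}\to{\cal C}'$ with morphisms $\phi:\Phi(U)\to U'$, $\widetilde\phi:\Phi(\widetilde U)\to\widetilde U'$ such that $\Phi(pt)$ is final, $\Phi$ takes pull-back squares based on $p$ to pull-back squares, and the square with sides $\widetilde\phi$, $p'$, $\Phi(p)$, $\phi$ (so that $\widetilde\phi\circ p'=\Phi(p)\circ\phi$) is a pull-back square. Let $${\bf\Phi}^2:D_p(X,V)\to D_{p'}(\Phi(X),\Phi(V)),\qquad {\bf\Phi}^2(F_1,F_2)=(\Phi(F_1)\circ\phi,\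 \iota\circ\Phi(F_2)),$$ where $\iota:(\Phi(X);\Phi(F_1)\circ\phi)\to\Phi(X;F_1)$ is the unique morphism with $\iota\circ\Phi(p_{X,F_1})=p_{\Phi(X),\Phi(F_1)\circ\phi}$ and $\iota\circ\Phi(Q(F_1))\circ\widetilde\phi=Q(\Phi(F_1)\circ\phi)$. If ${\cal C}$, ${\cal C}'$ are locally cartesian closed (no compatibility of $\Phi$ with these structures is assumed), put $$\chi_{\bf\Phi}(V)=\eta'({\bf\Phi}^2(\eta^{!}(Id_{I_p(V)}))):\Phi(I_p(V))\to I_{p'}(\Phi(V)),$$ $$\xi_{\bf\Phi}=\chi_{\bf\Phi}(U)\circ I_{p'}(\phi):\Phi(I_p(U))\to I_{p'}(U'),\qquad \widetilde\xi_{\bf\Phi}=\chi_{\bf\Phi}(\widetilde U)\circ I_{p'}(\widetilde\phi):\Phi(I_p(\widetilde U))\to I_{p'}(\widetilde U').$$ The functor ${\bf\Phi}$ induces a homomorphism of C-systems $H:CC({\cal C},p)\to CC({\cal C}',p')$ as follows. Let $\psi:pt'\to\Phi(pt)$ be the unique morphism. By induction on $n$ one defines $H$ and isomorphisms $\psi(A):int'(H(A))\to\Phi(int(A))$: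 on the point of $Ob_0$ the isomorphism is $\psi$; $H(A,F)=(H(A),\psi(A)\circ\Phi(F)\circ\phi)$; and $\psi(A,F)$ is the unique morphism with $\psi(A,F)\circ\Phi(Q(F))\circ\widetilde\phi=Q'(\psi(A)\circ\Phi(F)\circ\phi)$ and $\psi(A,F)\circ\Phi(p_{int(A),F})=p_{int'(H(A)),\,\psi(A)\circ\Phi(F)\circ\phi}\circ\psi(A)$. On morphisms $f:(m,A)\to(n,B)$, $H(f)=\psi(A)\circ\Phi(int(f))\circ\psi(B)^{-1}$. **Theorem.** Let ${\bf\Phi}=(\Phi,\phi,\widetilde\phi)$ be a universe category functor from $({\cal C},p,pt)$ to $({\cal C}',p',pt')$, where ${\cal C}$ and ${\cal C}'$ are locally cartesian closed, and let $(\widetilde P,P)$ and $(\widetilde P',P')$ be $\Pi$-structures on $p$ and $p'$. Assume that $$\xi_{\bf\Phi}\circ P'=\Phi(P)\circ\phi\ :\ \Phi(I_p(U))\to U'\qquad\text{and}\qquad \widetilde\xi_{\bf\Phi}\circ\widetilde P'=\Phi(\widetilde P)\circ\widetilde\phi\ :\ \Phi(I_p(\widetilde U))\to\widetilde U'.$$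 Then the homomorphism $H:CC({\cal C},p)\to CC({\cal C}',p')$ induced by ${\bf\Phi}$ is a homomorphism of C-systems with $(\Pi,\lambda)$-structures, where $CC({\cal C},p)$ and $CC({\cal C}',p')$ carry the $(\Pi,\lambda)$-structures defined by $(\widetilde P,P)$ and $(\widetilde P',P')$: for every object $\Gamma$ of $CC({\cal C},p)$, all $T\in Ob_2(\Gamma)$ and all $s\in\widetilde{Ob}_2(\Gamma)$, $$H(\Pi_\Gamma(T))=\Pi'_{H(\Gamma)}(H(T)),\qquad H(\lambda_\Gamma(s))=\lambda'_{H(\Gamma)}(H(s)).$$ -/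

import Mathlib

open CategoryTheory CategoryTheory.Limits

universe v u v' u' w w'

/-- A C-system (contextual category) on a category with object set `Ob`: a length function,
a distinguished final object `pt`, the father function `ft`, canonical projections
`p X : X ⟶ ft X`, and, for `0 < l X` and `f : Y ⟶ ft X`, a canonical pull-back square with
vertices `pull X f`, `X`, `Y`, `ft X`, strictly functorial in `f`. -/
structure CSystem (Ob : Type u) [Category.{v} Ob] where
  l : Ob → ℕ
  pt : Ob
  l_eq_zero_iff : ∀ X, l X = 0 ↔ X = pt
  ft : Ob → Ob
  l_ft : ∀ X, 0 < l X → l X = l (ft X) + 1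
  ft_pt : ft pt = pt
  isTerminal : ∀ X, Nonempty (Unique (X ⟶ pt))
  p : ∀ X, X ⟶ ft X
  pull : ∀ (X : Ob) (_ : 0 < l X) {Y : Ob} (_ : Y ⟶ ft X), Ob
  q : ∀ (X : Ob) (h : 0 < l X) {Y : Ob} (f : Y ⟶ ft X), pull X h f ⟶ X
  l_pull : ∀ (X : Ob) (h : 0 < l X) {Y : Ob} (f : Y ⟶ ft X), 0 < l (pull X h f)
  ft_pull : ∀ (X : Ob) (h : 0 < l X) {Y : Ob} (f : Y ⟶ ft X), ft (pull X h f) = Y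
  isPullback : ∀ (X : Ob) (h : 0 < l X) {Y : Ob} (f : Y ⟶ ft X),
    IsPullback (q X h f) (p (pull X h f) ≫ eqToHom (ft_pull X h f)) (p X) f
  pull_id : ∀ (X : Ob) (h : 0 < l X), pull X h (𝟙 (ft X)) = X
  q_id : ∀ (X : Ob) (h : 0 < l X), q X h (𝟙 (ft X)) = eqToHom (pull_id X h)
  pull_comp : ∀ (X : Ob) (h : 0 < l X) {Y Z : Ob} (f : Y ⟶ ft X) (g : Z ⟶ Y),
    pull X h (g ≫ f) = pull (pull X h f) (l_pull X h f) (g ≫ eqToHom (ft_pull X h f).symm)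
  q_comp : ∀ (X : Ob) (h : 0 < l X) {Y Z : Ob} (f : Y ⟶ ft X) (g : Z ⟶ Y),
    q X h (g ≫ f) = eqToHom (pull_comp X h f g) ≫
      q (pull X h f) (l_pull X h f) (g ≫ eqToHom (ft_pull X h f).symm) ≫ q X h f

namespace CSystem

section Basic

variable {Ob : Type u} [Category.{v} Ob] (S : CSystem Ob)

/-- `Δ` lies `n` levels above `Γ`. -/
def IsOver (n : ℕ) (Γ Δ : Ob) : Prop := n + S.l Γ ≤ S.l Δ ∧ S.ft^[n] Δ = Γ

/-- The set `Ob_n(Γ)`. -/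
def ObOver (n : ℕ) (Γ : Ob) : Type u := {Δ : Ob // S.IsOver n Γ Δ}

/-- The set of all sections `s : ft Δ ⟶ Δ` of canonical projections with `0 < l Δ`. -/
structure Sec where
  obj : Ob
  pos : 0 < S.l obj
  hom : S.ft obj ⟶ obj
  w : hom ≫ S.p obj = 𝟙 (S.ft obj)

/-- The set of sections `s : ft Δ ⟶ Δ` with `Δ ∈ Ob_n(Γ)`. -/
def SecOver (n : ℕ) (Γ : Ob) : Type (max u v) := {s : S.Sec // S.IsOver n Γ s.obj}

/-- The codomain `∂ s` of a section `s`. -/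
def bd {n : ℕ} {Γ : Ob} (s : S.SecOver n Γ) : S.ObOver n Γ := ⟨s.1.obj, s.2⟩

variable {S}

theorem IsOver.pos {n : ℕ} {Γ Δ : Ob} (h : S.IsOver (n + 1) Γ Δ) : 0 < S.l Δ := by
  have := h.1
  omega

theorem IsOver.ft {n : ℕ} {Γ Δ : Ob} (h : S.IsOver (n + 1) Γ Δ) : S.IsOver n Γ (S.ft Δ) := by
  have h1 := S.l_ft Δ h.pos
  have h2 := h.1
  exact ⟨by omega, h.2⟩

theorem IsOver.one {n : ℕ} {Γ Δ : Ob} (h : S.IsOver (n + 1) Γ Δ) : S.IsOver 1 (S.ft Δ) Δ := by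
  have h1 := S.l_ft Δ h.pos
  exact ⟨by omega, rfl⟩

theorem IsOver.of_ft {n : ℕ} {Γ Δ : Ob} (h : S.IsOver n Γ (S.ft Δ)) (h0 : 0 < S.l Δ) :
    S.IsOver (n + 1) Γ Δ := by
  have h1 := S.l_ft Δ h0
  have h2 := h.1
  exact ⟨by omega, h.2⟩

/-- The father function `Ob_{n+1}(Γ) → Ob_n(Γ)`. -/
def ObOver.ft {n : ℕ} {Γ : Ob} (Δ : S.ObOver (n + 1) Γ) : S.ObOver n Γ := ⟨S.ft Δ.1, Δ.2.ft⟩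

/-- An element of `Ob_{n+1}(Γ)` as an element of `Ob_1` of its father. -/
def ObOver.top {n : ℕ} {Γ : Ob} (Δ : S.ObOver (n + 1) Γ) : S.ObOver 1 (S.ft Δ.1) :=
  ⟨Δ.1, Δ.2.one⟩

/-- A section over an element of `Ob_{n+1}(Γ)` as a section over an element of `Ob_1` of its
domain. -/
def SecOver.top {n : ℕ} {Γ : Ob} (s : S.SecOver (n + 1) Γ) : S.SecOver 1 (S.ft s.1.obj) :=
  ⟨s.1, s.2.one⟩

variable (S)

/-- The iterated canonical pull-back `f^*(Δ, n)`, as the domain of the iterated canonical morphism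
`q(f, Δ, n) : f^*(Δ, n) ⟶ Δ`. -/
def iter : (n : ℕ) → {Γ Γ' : Ob} → (f : Γ' ⟶ Γ) → (Δ : S.ObOver n Γ) → Over Δ.1
  | 0, _, _, f, Δ => Over.mk (f ≫ eqToHom Δ.2.2.symm)
  | n + 1, _, _, f, Δ => Over.mk (S.q Δ.1 Δ.2.pos (iter n f Δ.ft).hom)

theorem iter_isOver (n : ℕ) {Γ Γ' : Ob} (f : Γ' ⟶ Γ) (Δ : S.ObOver n Γ) :
    S.IsOver n Γ' (S.iter n f Δ).left := by
  induction n with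
  | zero => exact ⟨by simp [iter], rfl⟩
  | succ n ih =>
    refine IsOver.of_ft ?_ (S.l_pull _ _ _)
    have h := S.ft_pull Δ.1 Δ.2.pos (S.iter n f Δ.ft).hom
    change S.IsOver n Γ' (S.ft (S.pull Δ.1 Δ.2.pos (S.iter n f Δ.ft).hom))
    rw [h]
    exact ih _

/-- The base change `f^* : Ob_n(Γ) → Ob_n(Γ')`. -/
def pullOb {n : ℕ} {Γ Γ' : Ob} (f : Γ' ⟶ Γ) (Δ : S.ObOver n Γ) : S.ObOver n Γ' :=
  ⟨(S.iter n f Δ).left, S.iter_isOver n f Δ⟩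

/-- The canonical pull-back `g^*(s)` of a section `s` of `p Δ` along `g : Y ⟶ ft Δ`: the unique
section of `p (g^* Δ)` with `g^*(s) ≫ q(g, Δ) = g ≫ s`. -/
noncomputable def Sec.pull (s : S.Sec) {Y : Ob} (g : Y ⟶ S.ft s.obj) : S.Sec where
  obj := S.pull s.obj s.pos g
  pos := S.l_pull _ _ _
  hom := eqToHom (S.ft_pull _ _ _) ≫ (S.isPullback s.obj s.pos g).lift (g ≫ s.hom) (𝟙 Y)
    (by simp [s.w])
  w := by
    have h := (S.isPullback s.obj s.pos g).lift_snd (g ≫ s.hom) (𝟙 Y) (by simp [s.w])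
    rw [← cancel_mono (eqToHom (S.ft_pull s.obj s.pos g)), Category.assoc, Category.assoc, h]
    simp

/-- The base change `f^*` of sections over elements of `Ob_{n+1}(Γ)`. -/
noncomputable def pullSec {n : ℕ} {Γ Γ' : Ob} (f : Γ' ⟶ Γ) (s : S.SecOver (n + 1) Γ) :
    S.SecOver (n + 1) Γ' :=
  ⟨Sec.pull S s.1 (S.iter n f (S.bd s).ft).hom, S.iter_isOver (n + 1) f (S.bd s)⟩

/-- A pre-`(Π, λ)`-structure. -/
structure PrePiLambda where
  Pi : ∀ {Γ : Ob}, S.ObOver 2 Γ → S.ObOver 1 Γ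
  lam : ∀ {Γ : Ob}, S.SecOver 2 Γ → S.SecOver 1 Γ
  bd_lam : ∀ {Γ : Ob} (s : S.SecOver 2 Γ), S.bd (lam s) = Pi (S.bd s)
  pull_Pi : ∀ {Γ Γ' : Ob} (f : Γ' ⟶ Γ) (T : S.ObOver 2 Γ),
    S.pullOb f (Pi T) = Pi (S.pullOb f T)
  pull_lam : ∀ {Γ Γ' : Ob} (f : Γ' ⟶ Γ) (s : S.SecOver 2 Γ),
    S.pullSec f (lam s) = lam (S.pullSec f s)

/-- A `(Π, λ)`-structure: a pre-`(Π, λ)`-structure such that, for every `Γ`, the square of sets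
formed by `λ`, `Π` and the two functions `∂` is a pull-back square. -/
structure PiLambda extends PrePiLambda S where
  existsUnique_lam : ∀ {Γ : Ob} (T : S.ObOver 2 Γ) (t : S.SecOver 1 Γ), S.bd t = Pi T →
    ∃! s : S.SecOver 2 Γ, S.bd s = T ∧ lam s = t

end Basic

section Hom

variable {Ob : Type u} [Category.{v} Ob] {Ob' : Type u'} [Category.{v'} Ob']

/-- A homomorphism of C-systems: a functor that strictly preserves lengths, fathers, canonical
projections and canonical squares. -/
structure Hom (S : CSystem Ob) (S' : CSystem Ob') extends Ob ⥤ Ob' where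
  l_obj : ∀ X, S'.l (obj X) = S.l X
  ft_obj : ∀ X, S'.ft (obj X) = obj (S.ft X)
  map_p : ∀ X, map (S.p X) = S'.p (obj X) ≫ eqToHom (ft_obj X)
  obj_pull : ∀ (X : Ob) (h : 0 < S.l X) {Y : Ob} (f : Y ⟶ S.ft X),
    obj (S.pull X h f) =
      S'.pull (obj X) ((l_obj X).symm ▸ h) (map f ≫ eqToHom (ft_obj X).symm)
  map_q : ∀ (X : Ob) (h : 0 < S.l X) {Y : Ob} (f : Y ⟶ S.ft X),
    map (S.q X h f) = eqToHom (obj_pull X h f) ≫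
      S'.q (obj X) ((l_obj X).symm ▸ h) (map f ≫ eqToHom (ft_obj X).symm)

namespace Hom

variable {S : CSystem Ob} {S' : CSystem Ob'} (H : Hom S S')

theorem isOver {n : ℕ} {Γ Δ : Ob} (h : S.IsOver n Γ Δ) : S'.IsOver n (H.obj Γ) (H.obj Δ) := by
  refine ⟨by rw [H.l_obj, H.l_obj]; exact h.1, ?_⟩
  rw [← h.2]
  exact ((Function.Semiconj.iterate_right (fun X => (H.ft_obj X).symm) n) Δ).symm

/-- The action of a homomorphism on `Ob_n(Γ)`. -/
def mapOb {n : ℕ} {Γ : Ob} (T : S.ObOver n Γ) : S'.ObOver n (H.obj Γ) :=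
  ⟨H.obj T.1, H.isOver T.2⟩

/-- The action of a homomorphism on sections. -/
def mapSec {n : ℕ} {Γ : Ob} (s : S.SecOver n Γ) : S'.SecOver n (H.obj Γ) :=
  ⟨{ obj := H.obj s.1.obj
     pos := (H.l_obj _).symm ▸ s.1.pos
     hom := eqToHom (H.ft_obj _) ≫ H.map s.1.hom
     w := by
      have h1 : H.map s.1.hom ≫ H.map (S.p s.1.obj) = 𝟙 _ := by
        rw [← H.map_comp, s.1.w, H.map_id]
      rw [H.map_p] at h1
      rw [← cancel_mono (eqToHom (H.ft_obj s.1.obj)), Category.assoc, Category.assoc, h1]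
      simp }, H.isOver s.2⟩

/-- A homomorphism of C-systems is a homomorphism of C-systems with `(Π, λ)`-structures if it
commutes with `Π` and with `λ`. -/
structure PreservesPiLambda (A : S.PiLambda) (A' : S'.PiLambda) : Prop where
  map_Pi : ∀ {Γ : Ob} (T : S.ObOver 2 Γ), H.mapOb (A.Pi T) = A'.Pi (H.mapOb T)
  map_lam : ∀ {Γ : Ob} (s : S.SecOver 2 Γ), H.mapSec (A.lam s) = A'.lam (H.mapSec s)

end Hom

end Hom

end CSystem

/-- A universe category: a category with a chosen final object `pt`, a morphism `p : Ut ⟶ U` and,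
for every `F : X ⟶ U`, a chosen pull-back square with vertices `(X;F)`, `Ut`, `X`, `U`. -/
structure UniverseCategory (C : Type u) [Category.{v} C] where
  pt : C
  isTerminal : IsTerminal pt
  U : C
  Ut : C
  p : Ut ⟶ U
  ext : ∀ {X : C}, (X ⟶ U) → C
  proj : ∀ {X : C} (F : X ⟶ U), ext F ⟶ X
  Q : ∀ {X : C} (F : X ⟶ U), ext F ⟶ Ut
  isPullback : ∀ {X : C} (F : X ⟶ U), IsPullback (Q F) (proj F) p F

namespace UniverseCategory

section Basic

variable {C : Type u} [Category.{v} C] (𝓤 : UniverseCategory C)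

/-- The morphism `f * g : W ⟶ (X;F)`. -/
noncomputable def pair {W X : C} (F : X ⟶ 𝓤.U) (f : W ⟶ X) (g : W ⟶ 𝓤.Ut)
    (h : g ≫ 𝓤.p = f ≫ F) : W ⟶ 𝓤.ext F :=
  (𝓤.isPullback F).lift g f h

@[simp] theorem pair_proj {W X : C} (F : X ⟶ 𝓤.U) (f : W ⟶ X) (g : W ⟶ 𝓤.Ut)
    (h : g ≫ 𝓤.p = f ≫ F) : 𝓤.pair F f g h ≫ 𝓤.proj F = f :=
  (𝓤.isPullback F).lift_snd _ _ _

@[simp] theorem pair_Q {W X : C} (F : X ⟶ 𝓤.U) (f : W ⟶ X) (g : W ⟶ 𝓤.Ut)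
    (h : g ≫ 𝓤.p = f ≫ F) : 𝓤.pair F f g h ≫ 𝓤.Q F = g :=
  (𝓤.isPullback F).lift_fst _ _ _

theorem hom_ext {W X : C} {F : X ⟶ 𝓤.U} {a b : W ⟶ 𝓤.ext F}
    (h₁ : a ≫ 𝓤.proj F = b ≫ 𝓤.proj F) (h₂ : a ≫ 𝓤.Q F = b ≫ 𝓤.Q F) : a = b :=
  (𝓤.isPullback F).hom_ext h₂ h₁

/-- The morphism `Q(f, F) : (X';f ≫ F) ⟶ (X;F)`. -/
noncomputable def Qmap {X' X : C} (f : X' ⟶ X) (F : X ⟶ 𝓤.U) : 𝓤.ext (f ≫ F) ⟶ 𝓤.ext F :=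
  𝓤.pair F (𝓤.proj (f ≫ F) ≫ f) (𝓤.Q (f ≫ F))
    (by rw [(𝓤.isPullback (f ≫ F)).w, Category.assoc])

@[simp] theorem Qmap_proj {X' X : C} (f : X' ⟶ X) (F : X ⟶ 𝓤.U) :
    𝓤.Qmap f F ≫ 𝓤.proj F = 𝓤.proj (f ≫ F) ≫ f := by simp [Qmap]

@[simp] theorem Qmap_Q {X' X : C} (f : X' ⟶ X) (F : X ⟶ 𝓤.U) :
    𝓤.Qmap f F ≫ 𝓤.Q F = 𝓤.Q (f ≫ F) := by simp [Qmap]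

@[simp] theorem eqToHom_proj {X : C} {F G : X ⟶ 𝓤.U} (h : F = G) (h' : 𝓤.ext F = 𝓤.ext G) :
    eqToHom h' ≫ 𝓤.proj G = 𝓤.proj F := by
  subst h; simp

@[simp] theorem eqToHom_Q {X : C} {F G : X ⟶ 𝓤.U} (h : F = G) (h' : 𝓤.ext F = 𝓤.ext G) :
    eqToHom h' ≫ 𝓤.Q G = 𝓤.Q F := by
  subst h; simp

theorem Qmap_isPullback {X' X : C} (f : X' ⟶ X) (F : X ⟶ 𝓤.U) :
    IsPullback (𝓤.Qmap f F) (𝓤.proj (f ≫ F)) (𝓤.proj F) f := by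
  refine IsPullback.of_right ?_ (𝓤.Qmap_proj f F) (𝓤.isPullback F)
  rw [Qmap_Q]
  exact 𝓤.isPullback (f ≫ F)

theorem Qmap_id {X : C} (F : X ⟶ 𝓤.U) (h : 𝓤.ext (𝟙 X ≫ F) = 𝓤.ext F) :
    𝓤.Qmap (𝟙 X) F = eqToHom h := by
  have h0 : 𝟙 X ≫ F = F := Category.id_comp F
  refine 𝓤.hom_ext ?_ ?_
  · rw [Qmap_proj, 𝓤.eqToHom_proj h0, Category.comp_id]
  · rw [Qmap_Q, 𝓤.eqToHom_Q h0]

theorem Qmap_comp {X'' X' X : C} (g : X'' ⟶ X') (f : X' ⟶ X) (F : X ⟶ 𝓤.U)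
    (h : 𝓤.ext ((g ≫ f) ≫ F) = 𝓤.ext (g ≫ f ≫ F)) :
    𝓤.Qmap (g ≫ f) F = eqToHom h ≫ 𝓤.Qmap g (f ≫ F) ≫ 𝓤.Qmap f F := by
  have h0 : (g ≫ f) ≫ F = g ≫ f ≫ F := Category.assoc _ _ _
  refine 𝓤.hom_ext ?_ ?_
  · have e := 𝓤.eqToHom_proj h0 h
    have e2 := congrArg (fun t => t ≫ g ≫ f) e
    simp only [Category.assoc] at e2
    have e3 : 𝓤.Qmap g (f ≫ F) ≫ 𝓤.Qmap f F ≫ 𝓤.proj F = 𝓤.proj (g ≫ f ≫ F) ≫ g ≫ f := by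
      rw [Qmap_proj, ← Category.assoc (𝓤.Qmap g (f ≫ F)), Qmap_proj, Category.assoc (𝓤.proj _)]
    rw [Qmap_proj]
    exact e2.symm.trans ((congrArg (eqToHom h ≫ ·) e3.symm).trans (by simp only [Category.assoc]))
  · simp only [Category.assoc, Qmap_Q]
    rw [𝓤.eqToHom_Q h0]

/-- The set `D_p(X, V)` of pairs of `F : X ⟶ U` and a morphism `(X;F) ⟶ V`. -/
def D (X V : C) : Type v := Σ F : X ⟶ 𝓤.U, (𝓤.ext F ⟶ V)

/-- The functoriality of `D_p(X, V)` in `X`. -/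
noncomputable def Dpre {X' X : C} (f : X' ⟶ X) (V : C) (d : 𝓤.D X V) : 𝓤.D X' V :=
  ⟨f ≫ d.1, 𝓤.Qmap f d.1 ≫ d.2⟩

/-- The functoriality of `D_p(X, V)` in `V`. -/
def Dpost (X : C) {V V' : C} (g : V ⟶ V') (d : 𝓤.D X V) : 𝓤.D X V' := ⟨d.1, d.2 ≫ g⟩

theorem D_ext {X V : C} {F G : X ⟶ 𝓤.U} (a : 𝓤.ext F ⟶ V) (b : 𝓤.ext G ⟶ V) (h : F = G)
    (h' : ∀ e : 𝓤.ext F = 𝓤.ext G, a = eqToHom e ≫ b) : (⟨F, a⟩ : 𝓤.D X V) = ⟨G, b⟩ := by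
  subst h
  have := h' rfl
  simp at this
  rw [this]

end Basic

end UniverseCategory

/-- A structure of a category with fiber products: a choice, for all `f : X ⟶ Z` and `g : Y ⟶ Z`,
of a pull-back square with vertices `(X,f) ×_Z (Y,g)`, `X`, `Y`, `Z`. -/
structure FiberProducts (C : Type u) [Category.{v} C] where
  fp : ∀ {X Y Z : C}, (X ⟶ Z) → (Y ⟶ Z) → C
  pr₁ : ∀ {X Y Z : C} (f : X ⟶ Z) (g : Y ⟶ Z), fp f g ⟶ X
  pr₂ : ∀ {X Y Z : C} (f : X ⟶ Z) (g : Y ⟶ Z), fp f g ⟶ Y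
  isPullback : ∀ {X Y Z : C} (f : X ⟶ Z) (g : Y ⟶ Z), IsPullback (pr₁ f g) (pr₂ f g) f g

namespace FiberProducts

variable {C : Type u} [Category.{v} C] (S : FiberProducts C)
variable {X X' X'' Y Y' Y'' Z : C} {f : X ⟶ Z} {f' : X' ⟶ Z} {f'' : X'' ⟶ Z}
variable {g : Y ⟶ Z} {g' : Y' ⟶ Z} {g'' : Y'' ⟶ Z}

/-- The morphism `a × b : (X,f) ×_Z (Y,g) ⟶ (X',f') ×_Z (Y',g')` defined by morphisms `a` and `b`
over `Z`. -/
noncomputable def map (a : X ⟶ X') (b : Y ⟶ Y') (ha : a ≫ f' = f) (hb : b ≫ g' = g) :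
    S.fp f g ⟶ S.fp f' g' :=
  (S.isPullback f' g').lift (S.pr₁ f g ≫ a) (S.pr₂ f g ≫ b)
    (by rw [Category.assoc, Category.assoc, ha, hb, (S.isPullback f g).w])

@[simp] theorem map_pr₁ (a : X ⟶ X') (b : Y ⟶ Y') (ha : a ≫ f' = f) (hb : b ≫ g' = g) :
    S.map a b ha hb ≫ S.pr₁ f' g' = S.pr₁ f g ≫ a := (S.isPullback f' g').lift_fst _ _ _

@[simp] theorem map_pr₂ (a : X ⟶ X') (b : Y ⟶ Y') (ha : a ≫ f' = f) (hb : b ≫ g' = g) :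
    S.map a b ha hb ≫ S.pr₂ f' g' = S.pr₂ f g ≫ b := (S.isPullback f' g').lift_snd _ _ _

theorem map_comp (a : X ⟶ X') (b : Y ⟶ Y') (ha : a ≫ f' = f) (hb : b ≫ g' = g)
    (a' : X' ⟶ X'') (b' : Y' ⟶ Y'') (ha' : a' ≫ f'' = f') (hb' : b' ≫ g'' = g')
    (ha'' : (a ≫ a') ≫ f'' = f) (hb'' : (b ≫ b') ≫ g'' = g) :
    S.map (a ≫ a') (b ≫ b') ha'' hb'' = S.map a b ha hb ≫ S.map a' b' ha' hb' := by
  refine (S.isPullback f'' g'').hom_ext ?_ ?_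
  · rw [map_pr₁, Category.assoc, map_pr₁, ← Category.assoc, ← Category.assoc, map_pr₁]
  · rw [map_pr₂, Category.assoc, map_pr₂, ← Category.assoc, ← Category.assoc, map_pr₂]

end FiberProducts

/-- A locally cartesian closed structure: chosen fiber products and, for all `f : X ⟶ Z` and
`g : Y ⟶ Z`, a chosen object `Hom_Z((X,f),(Y,g))` with a morphism `f △ g` to `Z`, functorial in
`(Y,g)`, with evaluation morphisms over `Z`, natural in `(Y,g)`, such that `u ↦ (u × Id_X) ≫ ev` is
a bijection from the morphisms `(W,h) ⟶ (Hom_Z((X,f),(Y,g)), f △ g)` over `Z` to the morphisms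
`(W,h) ×_Z (X,f) ⟶ (Y,g)` over `Z`. -/
structure LCCStructure (C : Type u) [Category.{v} C] extends FiberProducts C where
  ihom : ∀ {X Y Z : C}, (X ⟶ Z) → (Y ⟶ Z) → C
  tri : ∀ {X Y Z : C} (f : X ⟶ Z) (g : Y ⟶ Z), ihom f g ⟶ Z
  ihomMap : ∀ {X Y Y' Z : C} (f : X ⟶ Z) {g : Y ⟶ Z} {g' : Y' ⟶ Z} (a : Y ⟶ Y') (_ : a ≫ g' = g),
    ihom f g ⟶ ihom f g'
  ihomMap_tri : ∀ {X Y Y' Z : C} (f : X ⟶ Z) {g : Y ⟶ Z} {g' : Y' ⟶ Z} (a : Y ⟶ Y')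
    (ha : a ≫ g' = g), ihomMap f a ha ≫ tri f g' = tri f g
  ihomMap_id : ∀ {X Y Z : C} (f : X ⟶ Z) (g : Y ⟶ Z),
    ihomMap f (𝟙 Y) (Category.id_comp g) = 𝟙 (ihom f g)
  ihomMap_comp : ∀ {X Y Y' Y'' Z : C} (f : X ⟶ Z) {g : Y ⟶ Z} {g' : Y' ⟶ Z} {g'' : Y'' ⟶ Z}
    (a : Y ⟶ Y') (ha : a ≫ g' = g) (a' : Y' ⟶ Y'') (ha' : a' ≫ g'' = g'),
    ihomMap f (a ≫ a') ((Category.assoc a a' g'').trans ((congrArg (a ≫ ·) ha').trans ha)) =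
      ihomMap f a ha ≫ ihomMap f a' ha'
  ev : ∀ {X Y Z : C} (f : X ⟶ Z) (g : Y ⟶ Z), fp (tri f g) f ⟶ Y
  ev_over : ∀ {X Y Z : C} (f : X ⟶ Z) (g : Y ⟶ Z), ev f g ≫ g = pr₁ (tri f g) f ≫ tri f g
  ev_natural : ∀ {X Y Y' Z : C} (f : X ⟶ Z) {g : Y ⟶ Z} {g' : Y' ⟶ Z} (a : Y ⟶ Y')
    (ha : a ≫ g' = g),
    toFiberProducts.map (ihomMap f a ha) (𝟙 X) (ihomMap_tri f a ha) (Category.id_comp f) ≫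
      ev f g' = ev f g ≫ a
  adj_bijective : ∀ {W X Y Z : C} (h : W ⟶ Z) (f : X ⟶ Z) (g : Y ⟶ Z) (k : fp h f ⟶ Y),
    k ≫ g = pr₁ h f ≫ h → ∃! u : W ⟶ ihom f g, ∃ hu : u ≫ tri f g = h,
      toFiberProducts.map u (𝟙 X) hu (Category.id_comp f) ≫ ev f g = k

namespace UniverseCategory

section LCC

variable {C : Type u} [Category.{v} C] (𝓤 : UniverseCategory C) (L : LCCStructure C)

/-- The product `U × V`, which is the fiber product over `pt`. -/
abbrev UTimes (V : C) : C := L.fp (𝓤.isTerminal.from 𝓤.U) (𝓤.isTerminal.from V)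

/-- The projection `pr₁ : U × V ⟶ U`. -/
abbrev UFst (V : C) : 𝓤.UTimes L V ⟶ 𝓤.U :=
  L.pr₁ (𝓤.isTerminal.from 𝓤.U) (𝓤.isTerminal.from V)

/-- The projection `pr₂ : U × V ⟶ V`. -/
abbrev USnd (V : C) : 𝓤.UTimes L V ⟶ V :=
  L.pr₂ (𝓤.isTerminal.from 𝓤.U) (𝓤.isTerminal.from V)

/-- The morphism `Id_U × f : U × V ⟶ U × V'`. -/
noncomputable def UMap {V V' : C} (f : V ⟶ V') : 𝓤.UTimes L V ⟶ 𝓤.UTimes L V' :=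
  L.map (𝟙 𝓤.U) f (𝓤.isTerminal.hom_ext _ _) (𝓤.isTerminal.hom_ext _ _)

theorem UMap_UFst {V V' : C} (f : V ⟶ V') : 𝓤.UMap L f ≫ 𝓤.UFst L V' = 𝓤.UFst L V := by
  simp [UMap]

theorem UMap_USnd {V V' : C} (f : V ⟶ V') : 𝓤.UMap L f ≫ 𝓤.USnd L V' = 𝓤.USnd L V ≫ f := by
  simp [UMap]

/-- The object `I_p(V) = Hom_U((Ut,p),(U × V,pr₁))`. -/
abbrev Ip (V : C) : C := L.ihom 𝓤.p (𝓤.UFst L V)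

/-- The morphism `prI_p(V) = p △ pr₁ : I_p(V) ⟶ U`. -/
abbrev prIp (V : C) : 𝓤.Ip L V ⟶ 𝓤.U := L.tri 𝓤.p (𝓤.UFst L V)

/-- The morphism `I_p(f) : I_p(V) ⟶ I_p(V')`. -/
noncomputable def IpMap {V V' : C} (f : V ⟶ V') : 𝓤.Ip L V ⟶ 𝓤.Ip L V' :=
  L.ihomMap 𝓤.p (𝓤.UMap L f) (𝓤.UMap_UFst L f)

theorem IpMap_prIp {V V' : C} (f : V ⟶ V') : 𝓤.IpMap L f ≫ 𝓤.prIp L V' = 𝓤.prIp L V :=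
  L.ihomMap_tri _ _ _

/-- The canonical isomorphism `ι_F : (X;F) ⟶ (X,F) ×_U (Ut,p)`. -/
noncomputable def iota {X : C} (F : X ⟶ 𝓤.U) : 𝓤.ext F ⟶ L.fp F 𝓤.p :=
  (L.isPullback F 𝓤.p).lift (𝓤.proj F) (𝓤.Q F) (𝓤.isPullback F).w.symm

@[simp] theorem iota_pr₁ {X : C} (F : X ⟶ 𝓤.U) : 𝓤.iota L F ≫ L.pr₁ F 𝓤.p = 𝓤.proj F :=
  (L.isPullback F 𝓤.p).lift_fst _ _ _

@[simp] theorem iota_pr₂ {X : C} (F : X ⟶ 𝓤.U) : 𝓤.iota L F ≫ L.pr₂ F 𝓤.p = 𝓤.Q F :=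
  (L.isPullback F 𝓤.p).lift_snd _ _ _

/-- The morphism `st_p(V) : (I_p(V);prI_p(V)) ⟶ V`. -/
noncomputable def st (V : C) : 𝓤.ext (𝓤.prIp L V) ⟶ V :=
  𝓤.iota L (𝓤.prIp L V) ≫ L.ev 𝓤.p (𝓤.UFst L V) ≫ 𝓤.USnd L V

/-- The function `η^! : Hom(X, I_p(V)) → D_p(X, V)`. -/
noncomputable def etaInv (X V : C) (g : X ⟶ 𝓤.Ip L V) : 𝓤.D X V :=
  ⟨g ≫ 𝓤.prIp L V, 𝓤.Qmap g (𝓤.prIp L V) ≫ 𝓤.st L V⟩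

theorem existsUnique_adj_snd {X : C} (F : X ⟶ 𝓤.U) (V : C) (b : 𝓤.ext F ⟶ V) :
    ∃! g : X ⟶ 𝓤.Ip L V, ∃ hg : g ≫ 𝓤.prIp L V = F,
      𝓤.iota L F ≫ (L.map g (𝟙 𝓤.Ut) hg (Category.id_comp 𝓤.p) ≫ L.ev 𝓤.p (𝓤.UFst L V)) ≫
        𝓤.USnd L V = b := by
  have hU := L.isPullback (𝓤.isTerminal.from 𝓤.U) (𝓤.isTerminal.from V)
  -- the inverse of `ι_F`
  let j : L.fp F 𝓤.p ⟶ 𝓤.ext F :=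
    𝓤.pair F (L.pr₁ F 𝓤.p) (L.pr₂ F 𝓤.p) (L.isPullback F 𝓤.p).w.symm
  have hji : j ≫ 𝓤.iota L F = 𝟙 _ := (L.isPullback F 𝓤.p).hom_ext
    (by rw [Category.assoc, iota_pr₁, pair_proj, Category.id_comp])
    (by rw [Category.assoc, iota_pr₂, pair_Q, Category.id_comp])
  have hij : 𝓤.iota L F ≫ j = 𝟙 _ := 𝓤.hom_ext
    (by rw [Category.assoc, pair_proj, iota_pr₁, Category.id_comp])
    (by rw [Category.assoc, pair_Q, iota_pr₂, Category.id_comp])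
  let k : L.fp F 𝓤.p ⟶ 𝓤.UTimes L V :=
    hU.lift (L.pr₁ F 𝓤.p ≫ F) (j ≫ b) (𝓤.isTerminal.hom_ext _ _)
  have hk1 : k ≫ 𝓤.UFst L V = L.pr₁ F 𝓤.p ≫ F := hU.lift_fst _ _ _
  have hk2 : k ≫ 𝓤.USnd L V = j ≫ b := hU.lift_snd _ _ _
  obtain ⟨u, ⟨hu, hu'⟩, huniq⟩ := L.adj_bijective F 𝓤.p (𝓤.UFst L V) k hk1
  refine ⟨u, ⟨hu, ?_⟩, ?_⟩
  · rw [hu', hk2, ← Category.assoc, hij, Category.id_comp]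
  · rintro g ⟨hg, hg'⟩
    refine huniq g ⟨hg, hU.hom_ext ?_ ?_⟩
    · rw [hk1, Category.assoc, L.ev_over, ← Category.assoc, FiberProducts.map_pr₁, Category.assoc,
        hg]
    · rw [hk2, ← hg', ← Category.assoc j, hji, Category.id_comp]

theorem etaInv_eq {X V : C} (F : X ⟶ 𝓤.U) (g : X ⟶ 𝓤.Ip L V) (hg : g ≫ 𝓤.prIp L V = F) :
    𝓤.etaInv L X V g = ⟨F, 𝓤.iota L F ≫ (L.map g (𝟙 𝓤.Ut) hg (Category.id_comp 𝓤.p) ≫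
      L.ev 𝓤.p (𝓤.UFst L V)) ≫ 𝓤.USnd L V⟩ := by
  subst hg
  refine congrArg (Sigma.mk _) ?_
  have key : 𝓤.Qmap g (𝓤.prIp L V) ≫ 𝓤.iota L (𝓤.prIp L V) =
      𝓤.iota L (g ≫ 𝓤.prIp L V) ≫ L.map g (𝟙 𝓤.Ut) rfl (Category.id_comp 𝓤.p) := by
    refine (L.isPullback (𝓤.prIp L V) 𝓤.p).hom_ext ?_ ?_
    · rw [Category.assoc, Category.assoc, iota_pr₁, Qmap_proj, FiberProducts.map_pr₁,
        ← Category.assoc, iota_pr₁]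
    · rw [Category.assoc, Category.assoc, iota_pr₂, Qmap_Q, FiberProducts.map_pr₂,
        Category.comp_id, iota_pr₂]
  have k2 := congrArg (fun t => t ≫ L.ev 𝓤.p (𝓤.UFst L V) ≫ 𝓤.USnd L V) key
  simp only [Category.assoc] at k2
  simpa only [st, Category.assoc] using k2

theorem etaInv_bijective (X V : C) : Function.Bijective (𝓤.etaInv L X V) := by
  constructor
  · intro g g' h
    have h1 : g ≫ 𝓤.prIp L V = g' ≫ 𝓤.prIp L V := congrArg Sigma.fst h
    rw [𝓤.etaInv_eq L _ g h1, 𝓤.etaInv_eq L _ g' rfl] at h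
    have h2 := eq_of_heq (Sigma.mk.inj h).2
    exact (𝓤.existsUnique_adj_snd L _ V _).unique ⟨h1, h2⟩ ⟨rfl, rfl⟩
  · rintro ⟨F, b⟩
    obtain ⟨g, ⟨hg, hg'⟩, -⟩ := 𝓤.existsUnique_adj_snd L F V b
    exact ⟨g, (𝓤.etaInv_eq L F g hg).trans (congrArg (Sigma.mk F) hg')⟩

/-- The bijection `η : D_p(X, V) → Hom(X, I_p(V))`, the inverse of `η^!`. -/
noncomputable def eta (X V : C) : 𝓤.D X V ≃ (X ⟶ 𝓤.Ip L V) :=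
  (Equiv.ofBijective _ (𝓤.etaInv_bijective L X V)).symm

theorem etaInv_eta {X V : C} (d : 𝓤.D X V) : 𝓤.etaInv L X V (𝓤.eta L X V d) = d :=
  (Equiv.ofBijective _ (𝓤.etaInv_bijective L X V)).apply_symm_apply d

theorem eta_etaInv {X V : C} (g : X ⟶ 𝓤.Ip L V) : 𝓤.eta L X V (𝓤.etaInv L X V g) = g :=
  (Equiv.ofBijective _ (𝓤.etaInv_bijective L X V)).symm_apply_apply g

theorem eta_Dpre {X' X V : C} (f : X' ⟶ X) (d : 𝓤.D X V) :
    𝓤.eta L X' V (𝓤.Dpre f V d) = f ≫ 𝓤.eta L X V d := by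
  obtain ⟨g, rfl⟩ := (𝓤.etaInv_bijective L X V).2 d
  rw [eta_etaInv]
  apply (𝓤.etaInv_bijective L X' V).1
  rw [etaInv_eta]
  refine 𝓤.D_ext _ _ (Category.assoc _ _ _).symm fun e => ?_
  have e' : 𝓤.ext (f ≫ g ≫ 𝓤.prIp L V) = 𝓤.ext ((f ≫ g) ≫ 𝓤.prIp L V) := e
  change 𝓤.Qmap f (g ≫ 𝓤.prIp L V) ≫ 𝓤.Qmap g (𝓤.prIp L V) ≫ 𝓤.st L V =
    eqToHom e' ≫ 𝓤.Qmap (f ≫ g) (𝓤.prIp L V) ≫ 𝓤.st L V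
  rw [𝓤.Qmap_comp f g (𝓤.prIp L V) e'.symm]
  simp

theorem eta_Dpost {X V V' : C} (f : V ⟶ V') (d : 𝓤.D X V) :
    𝓤.eta L X V' (𝓤.Dpost X f d) = 𝓤.eta L X V d ≫ 𝓤.IpMap L f := by
  obtain ⟨g, rfl⟩ := (𝓤.etaInv_bijective L X V).2 d
  rw [eta_etaInv]
  apply (𝓤.etaInv_bijective L X V').1
  rw [etaInv_eta]
  have e0 : (g ≫ 𝓤.IpMap L f) ≫ 𝓤.prIp L V' = g ≫ 𝓤.prIp L V := by
    rw [Category.assoc, IpMap_prIp]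
  rw [𝓤.etaInv_eq L _ g rfl, 𝓤.etaInv_eq L _ _ e0]
  refine congrArg (Sigma.mk (g ≫ 𝓤.prIp L V)) ?_
  have e2 : L.map (g ≫ 𝓤.IpMap L f) (𝟙 𝓤.Ut) e0 (Category.id_comp 𝓤.p) =
      L.map g (𝟙 𝓤.Ut) rfl (Category.id_comp 𝓤.p) ≫
        L.map (𝓤.IpMap L f) (𝟙 𝓤.Ut) (𝓤.IpMap_prIp L f) (Category.id_comp 𝓤.p) := by
    rw [← L.map_comp _ _ _ _ _ _ _ _ e0 (by simp)]
    simp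
  have e4 : L.map (𝓤.IpMap L f) (𝟙 𝓤.Ut) (𝓤.IpMap_prIp L f) (Category.id_comp 𝓤.p) ≫
      L.ev 𝓤.p (𝓤.UFst L V') = L.ev 𝓤.p (𝓤.UFst L V) ≫ 𝓤.UMap L f :=
    L.ev_natural 𝓤.p (𝓤.UMap L f) (𝓤.UMap_UFst L f)
  have e5 := congrArg (fun t => 𝓤.iota L (g ≫ 𝓤.prIp L V) ≫
    (L.map g (𝟙 𝓤.Ut) rfl (Category.id_comp 𝓤.p) ≫ t) ≫ 𝓤.USnd L V') e4
  rw [e2]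
  simp only [Category.assoc, UMap_USnd] at e5 ⊢
  exact e5.symm

/-- A `Π`-structure on a universe in a locally cartesian closed category. -/
structure PiStructure where
  Pt : 𝓤.Ip L 𝓤.Ut ⟶ 𝓤.Ut
  P : 𝓤.Ip L 𝓤.U ⟶ 𝓤.U
  isPullback : IsPullback Pt (𝓤.IpMap L 𝓤.p) 𝓤.p P

end LCC

end UniverseCategory

namespace UniverseCategory

section CC

variable {C : Type u} [Category.{v} C] (𝓤 : UniverseCategory C)

/-- The sets `Ob_n(C, p)` together with the functions `int_n : Ob_n(C, p) → C`. -/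
def tower : ℕ → (T : Type v) × (T → C)
  | 0 => ⟨PUnit, fun _ => 𝓤.pt⟩
  | n + 1 => ⟨(A : (tower n).1) × ((tower n).2 A ⟶ 𝓤.U), fun A => 𝓤.ext A.2⟩

/-- The set of objects of `CC(C, p)`. -/
structure CC where
  n : ℕ
  A : (𝓤.tower n).1

namespace CC

variable {𝓤}

/-- The function `int` on objects. -/
def int (X : 𝓤.CC) : C := (𝓤.tower X.n).2 X.A

/-- Morphisms `X ⟶ Y` in `CC(C, p)` are the morphisms `int X ⟶ int Y` in `C`. -/
@[ext] structure Hom (X Y : 𝓤.CC) where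
  int : X.int ⟶ Y.int

instance : Category 𝓤.CC where
  Hom X Y := Hom X Y
  id X := ⟨𝟙 X.int⟩
  comp f g := ⟨f.int ≫ g.int⟩

@[ext] theorem hom_ext {X Y : 𝓤.CC} {f g : X ⟶ Y} (h : f.int = g.int) : f = g := Hom.ext h

@[simp] theorem id_int (X : 𝓤.CC) : (𝟙 X : X ⟶ X).int = 𝟙 X.int := rfl

@[simp] theorem comp_int {X Y Z : 𝓤.CC} (f : X ⟶ Y) (g : Y ⟶ Z) :
    (f ≫ g).int = f.int ≫ g.int := rfl

@[simp] theorem eqToHom_int {X Y : 𝓤.CC} (h : X = Y) :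
    (eqToHom h).int = eqToHom (congrArg int h) := by
  subst h; rfl

/-- The functor `int : CC(C, p) ⥤ C`. -/
def intFunctor : 𝓤.CC ⥤ C where
  obj := int
  map f := f.int

instance : (intFunctor (𝓤 := 𝓤)).Full where
  map_surjective f := ⟨⟨f⟩, rfl⟩

instance : (intFunctor (𝓤 := 𝓤)).Faithful where
  map_injective h := hom_ext h

theorem isPullback_of_int {W X Y Z : 𝓤.CC} {a : W ⟶ X} {b : W ⟶ Y} {c : X ⟶ Z} {d : Y ⟶ Z}
    (h : IsPullback a.int b.int c.int d.int) : IsPullback a b c d :=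
  IsPullback.of_map_of_faithful intFunctor (f := a) (g := b) (h := c) (i := d) h

/-- The object `(n + 1, (A, F))` for an object `X = (n, A)` and `F : int X ⟶ U`. -/
def cons (X : 𝓤.CC) (F : X.int ⟶ 𝓤.U) : 𝓤.CC := ⟨X.n + 1, ⟨X.A, F⟩⟩

@[simp] theorem cons_int (X : 𝓤.CC) (F : X.int ⟶ 𝓤.U) : (X.cons F).int = 𝓤.ext F := rfl

/-- The function `ft`, which sends `(n + 1, (A, F))` to `(n, A)`. -/
def ft : 𝓤.CC → 𝓤.CC
  | ⟨0, A⟩ => ⟨0, A⟩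
  | ⟨n + 1, A⟩ => ⟨n, A.1⟩

@[simp] theorem ft_cons (X : 𝓤.CC) (F : X.int ⟶ 𝓤.U) : (X.cons F).ft = X := rfl

/-- The morphism `F : int (ft X) ⟶ U` for `X = (n + 1, (A, F))`. -/
def top : (X : 𝓤.CC) → 0 < X.n → (X.ft.int ⟶ 𝓤.U)
  | ⟨0, _⟩, h => absurd h (Nat.lt_irrefl 0)
  | ⟨_ + 1, A⟩, _ => A.2

theorem exists_cons (X : 𝓤.CC) (h : 0 < X.n) :
    ∃ (Y : 𝓤.CC) (F : Y.int ⟶ 𝓤.U), X = Y.cons F := by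
  obtain ⟨n, A⟩ := X
  cases n with
  | zero => exact absurd h (Nat.lt_irrefl 0)
  | succ n => exact ⟨⟨n, A.1⟩, A.2, rfl⟩

/-- The canonical projections. -/
def proj : (X : 𝓤.CC) → (X ⟶ X.ft)
  | ⟨0, A⟩ => 𝟙 (⟨0, A⟩ : 𝓤.CC)
  | ⟨_ + 1, A⟩ => ⟨𝓤.proj A.2⟩

/-- The canonical pull-back of objects: it sends `X = (n + 1, (A, F))` to `(Y; int(f) ≫ F)`. -/
def pull (X : 𝓤.CC) (h : 0 < X.n) {Y : 𝓤.CC} (f : Y ⟶ X.ft) : 𝓤.CC := Y.cons (f.int ≫ X.top h)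

/-- The canonical morphisms. -/
noncomputable def q : (X : 𝓤.CC) → (h : 0 < X.n) → {Y : 𝓤.CC} → (f : Y ⟶ X.ft) → (X.pull h f ⟶ X)
  | ⟨0, _⟩, h, _, _ => absurd h (Nat.lt_irrefl 0)
  | ⟨_ + 1, A⟩, _, _, f => ⟨𝓤.Qmap f.int A.2⟩

theorem cons_congr {X Y : 𝓤.CC} (h : X = Y) (F : X.int ⟶ 𝓤.U) (G : Y.int ⟶ 𝓤.U)
    (h' : F = eqToHom (congrArg int h) ≫ G) : X.cons F = Y.cons G := by
  subst h
  simp at h'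
  rw [h']

theorem proj_cons (X : 𝓤.CC) (F : X.int ⟶ 𝓤.U) : (X.cons F).proj.int = 𝓤.proj F := rfl

theorem q_cons (X : 𝓤.CC) (F : X.int ⟶ 𝓤.U) (h : 0 < (X.cons F).n) {Y : 𝓤.CC} (f : Y ⟶ X) :
    (q (X.cons F) h f).int = 𝓤.Qmap f.int F := rfl

theorem pull_cons (X : 𝓤.CC) (F : X.int ⟶ 𝓤.U) (h : 0 < (X.cons F).n) {Y : 𝓤.CC} (f : Y ⟶ X) :
    pull (X.cons F) h f = Y.cons (f.int ≫ F) := rfl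

end CC

/-- The C-system `CC(C, p)`. -/
noncomputable def cSystem : CSystem 𝓤.CC where
  l X := X.n
  pt := ⟨0, PUnit.unit⟩
  l_eq_zero_iff X := by
    obtain ⟨n, A⟩ := X
    constructor
    · intro h
      obtain rfl : n = 0 := h
      rfl
    · intro h
      exact congrArg CC.n h
  ft := CC.ft
  l_ft X h := by
    obtain ⟨Y, F, rfl⟩ := X.exists_cons h
    rfl
  ft_pt := rfl
  isTerminal X := ⟨⟨⟨⟨𝓤.isTerminal.from X.int⟩⟩, fun f => CC.hom_ext (𝓤.isTerminal.hom_ext _ _)⟩⟩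
  p := CC.proj
  pull X h _ f := CC.pull X h f
  q X h _ f := CC.q X h f
  l_pull _ _ _ _ := Nat.succ_pos _
  ft_pull _ _ _ _ := rfl
  isPullback X h Y f := by
    obtain ⟨X, F, rfl⟩ := X.exists_cons h
    apply CC.isPullback_of_int
    have h1 := 𝓤.Qmap_isPullback (CC.Hom.int f) F
    have h2 : (CC.proj (CC.pull (X.cons F) h f) ≫ 𝟙 Y).int = 𝓤.proj (CC.Hom.int f ≫ F) :=
      Category.comp_id (𝓤.proj (CC.Hom.int f ≫ F))
    exact h2.symm ▸ h1
  pull_id X h := by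
    obtain ⟨X, F, rfl⟩ := X.exists_cons h
    exact CC.cons_congr rfl _ _ rfl
  q_id X h := by
    obtain ⟨X, F, rfl⟩ := X.exists_cons h
    apply CC.hom_ext
    rw [CC.eqToHom_int]
    exact 𝓤.Qmap_id F _
  pull_comp X h Y Z f g := by
    obtain ⟨X, F, rfl⟩ := X.exists_cons h
    refine CC.cons_congr rfl _ _ ?_
    change (g.int ≫ CC.Hom.int f) ≫ F = 𝟙 _ ≫ (g.int ≫ 𝟙 _) ≫ CC.Hom.int f ≫ F
    simp
  q_comp X h Y Z f g := by
    obtain ⟨X, F, rfl⟩ := X.exists_cons h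
    apply CC.hom_ext
    rw [CC.comp_int, CC.eqToHom_int, CC.comp_int]
    have h1 : ∀ (g' : Z.int ⟶ Y.int) (hg : g' = g.int)
        (e : 𝓤.ext ((g.int ≫ CC.Hom.int f) ≫ F) = 𝓤.ext (g' ≫ CC.Hom.int f ≫ F)),
        𝓤.Qmap (g.int ≫ CC.Hom.int f) F =
          eqToHom e ≫ 𝓤.Qmap g' (CC.Hom.int f ≫ F) ≫ 𝓤.Qmap (CC.Hom.int f) F := by
      rintro g' rfl e
      exact 𝓤.Qmap_comp g.int (CC.Hom.int f) F e
    exact h1 (g.int ≫ 𝟙 _) (Category.comp_id _) _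

end CC

end UniverseCategory

namespace UniverseCategory

section Bijections

variable {C : Type u} [Category.{v} C] (𝓤 : UniverseCategory C)

/-- The element `(n + 1, (A, F))` of `Ob_1(Γ)` for `Γ = (n, A)`. -/
def mkOb₁ (Γ : 𝓤.CC) (F : Γ.int ⟶ 𝓤.U) : 𝓤.cSystem.ObOver 1 Γ :=
  ⟨Γ.cons F, (Nat.add_comm 1 Γ.n).le, rfl⟩

/-- The element `(n + 2, ((A, F₁), F₂))` of `Ob_2(Γ)` for `Γ = (n, A)`. -/
def mkOb₂ (Γ : 𝓤.CC) (d : 𝓤.D Γ.int 𝓤.U) : 𝓤.cSystem.ObOver 2 Γ :=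
  ⟨(Γ.cons d.1).cons d.2, (Nat.add_comm 2 Γ.n).le, rfl⟩

/-- The section of the canonical projection of `(Γ;F)` defined by a lift `g` of `F` to `Ut`. -/
noncomputable def mkSec (Γ : 𝓤.CC) (F : Γ.int ⟶ 𝓤.U) (g : Γ.int ⟶ 𝓤.Ut) (h : g ≫ 𝓤.p = F) :
    𝓤.cSystem.Sec where
  obj := Γ.cons F
  pos := Nat.succ_pos _
  hom := ⟨𝓤.pair F (𝟙 Γ.int) g (h.trans (Category.id_comp F).symm)⟩
  w := CC.hom_ext (𝓤.pair_proj F (𝟙 Γ.int) g _)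

/-- The element of the set of sections over `Ob_1(Γ)` defined by `g : int Γ ⟶ Ut`. -/
noncomputable def mkSec₁ (Γ : 𝓤.CC) (g : Γ.int ⟶ 𝓤.Ut) : 𝓤.cSystem.SecOver 1 Γ :=
  ⟨𝓤.mkSec Γ (g ≫ 𝓤.p) g rfl, (𝓤.mkOb₁ Γ (g ≫ 𝓤.p)).2⟩

/-- The element of the set of sections over `Ob_2(Γ)` defined by an element of
`D_p(int Γ, Ut)`. -/
noncomputable def mkSec₂ (Γ : 𝓤.CC) (d : 𝓤.D Γ.int 𝓤.Ut) : 𝓤.cSystem.SecOver 2 Γ :=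
  ⟨𝓤.mkSec (Γ.cons d.1) (d.2 ≫ 𝓤.p) d.2 rfl, (𝓤.mkOb₂ Γ (𝓤.Dpost _ 𝓤.p d)).2⟩

variable {𝓤}

theorem exists_mkOb₁ {Γ : 𝓤.CC} (T : 𝓤.cSystem.ObOver 1 Γ) : ∃ F, T = 𝓤.mkOb₁ Γ F := by
  obtain ⟨Δ, hΔ⟩ := T
  obtain ⟨Y, F, rfl⟩ := Δ.exists_cons hΔ.pos
  obtain rfl : Y = Γ := hΔ.2
  exact ⟨F, rfl⟩

theorem exists_mkOb₂ {Γ : 𝓤.CC} (T : 𝓤.cSystem.ObOver 2 Γ) : ∃ d, T = 𝓤.mkOb₂ Γ d := by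
  obtain ⟨Δ, hΔ⟩ := T
  obtain ⟨Y, F₂, rfl⟩ := Δ.exists_cons hΔ.pos
  obtain ⟨Z, F₁, rfl⟩ := Y.exists_cons hΔ.ft.pos
  obtain rfl : Z = Γ := hΔ.2
  exact ⟨⟨F₁, F₂⟩, rfl⟩

theorem exists_mkSec (s : 𝓤.cSystem.Sec) : ∃ Γ g, s = 𝓤.mkSec Γ (g ≫ 𝓤.p) g rfl := by
  obtain ⟨Δ, hpos, s, w⟩ := s
  obtain ⟨Γ, F, rfl⟩ := Δ.exists_cons hpos
  let s' : Γ.int ⟶ 𝓤.ext F := CC.Hom.int s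
  have w' : s' ≫ 𝓤.proj F = 𝟙 Γ.int := congrArg CC.Hom.int w
  have hF : (s' ≫ 𝓤.Q F) ≫ 𝓤.p = F := by
    rw [Category.assoc, (𝓤.isPullback F).w, ← Category.assoc, w', Category.id_comp]
  have hs : ∀ (G : Γ.int ⟶ 𝓤.U) (h : (s' ≫ 𝓤.Q F) ≫ 𝓤.p = G), G = F →
      (⟨Γ.cons F, hpos, s, w⟩ : 𝓤.cSystem.Sec) = 𝓤.mkSec Γ G (s' ≫ 𝓤.Q F) h := by
    rintro G h rfl
    unfold mkSec
    congr 1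
    apply CC.hom_ext
    refine 𝓤.hom_ext (w'.trans (𝓤.pair_proj _ _ _ _).symm) (𝓤.pair_Q _ _ _ _).symm
  exact ⟨Γ, s' ≫ 𝓤.Q F, hs _ rfl hF⟩

theorem exists_mkSec₁ {Γ : 𝓤.CC} (s : 𝓤.cSystem.SecOver 1 Γ) : ∃ g, s = 𝓤.mkSec₁ Γ g := by
  obtain ⟨s, hs⟩ := s
  obtain ⟨Y, g, rfl⟩ := exists_mkSec s
  obtain rfl : Y = Γ := hs.2
  exact ⟨g, rfl⟩

theorem exists_mkSec₂ {Γ : 𝓤.CC} (s : 𝓤.cSystem.SecOver 2 Γ) : ∃ d, s = 𝓤.mkSec₂ Γ d := by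
  obtain ⟨s, hs⟩ := s
  obtain ⟨Y, g, rfl⟩ := exists_mkSec s
  obtain ⟨Z, F₁, rfl⟩ := Y.exists_cons hs.ft.pos
  obtain rfl : Z = Γ := hs.2
  exact ⟨⟨F₁, g⟩, rfl⟩

variable (𝓤)

/-- The bijection `u_{1,Γ} : Ob_1(Γ) → Hom(int Γ, U)`. -/
def u₁ (Γ : 𝓤.CC) : 𝓤.cSystem.ObOver 1 Γ ≃ (Γ.int ⟶ 𝓤.U) where
  toFun T := eqToHom (congrArg CC.int (show Γ = CC.ft T.1 from T.2.2.symm)) ≫ CC.top T.1 T.2.pos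
  invFun F := 𝓤.mkOb₁ Γ F
  left_inv T := by
    obtain ⟨F, rfl⟩ := exists_mkOb₁ T
    exact congrArg (𝓤.mkOb₁ Γ) (Category.id_comp F)
  right_inv F := Category.id_comp F

theorem u₁_mkOb₁ (Γ : 𝓤.CC) (F : Γ.int ⟶ 𝓤.U) : 𝓤.u₁ Γ (𝓤.mkOb₁ Γ F) = F :=
  (𝓤.u₁ Γ).right_inv F

/-- The equality `int(T) = (int Γ; u₁(T))` for `T ∈ Ob_1(Γ)`. -/
theorem int_eq_ext {Γ : 𝓤.CC} (T : 𝓤.cSystem.ObOver 1 Γ) :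
    CC.int T.1 = 𝓤.ext (𝓤.u₁ Γ T) := by
  obtain ⟨F, rfl⟩ := exists_mkOb₁ T
  rw [u₁_mkOb₁]
  rfl

/-- The function `o ↦ int(o) ≫ Q(u₁(∂ o))`. -/
noncomputable def uTilde₁Fun (Γ : 𝓤.CC) (o : 𝓤.cSystem.SecOver 1 Γ) : Γ.int ⟶ 𝓤.Ut :=
  eqToHom (congrArg CC.int (show Γ = CC.ft o.1.obj from o.2.2.symm)) ≫ CC.Hom.int o.1.hom ≫
    eqToHom (𝓤.int_eq_ext (𝓤.cSystem.bd o)) ≫ 𝓤.Q (𝓤.u₁ Γ (𝓤.cSystem.bd o))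

theorem uTilde₁Fun_mkSec₁ (Γ : 𝓤.CC) (g : Γ.int ⟶ 𝓤.Ut) :
    𝓤.uTilde₁Fun Γ (𝓤.mkSec₁ Γ g) = g := by
  have h1 : ∀ (G : Γ.int ⟶ 𝓤.U) (hG : g ≫ 𝓤.p = G) (e : 𝓤.ext (g ≫ 𝓤.p) = 𝓤.ext G),
      𝟙 Γ.int ≫ 𝓤.pair (g ≫ 𝓤.p) (𝟙 Γ.int) g (by simp) ≫ eqToHom e ≫ 𝓤.Q G = g := by
    rintro G rfl e
    simp
  exact h1 _ (𝓤.u₁_mkOb₁ Γ (g ≫ 𝓤.p)).symm _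

/-- The bijection from the set of sections over `Ob_1(Γ)` to `Hom(int Γ, Ut)`. -/
noncomputable def uTilde₁ (Γ : 𝓤.CC) : 𝓤.cSystem.SecOver 1 Γ ≃ (Γ.int ⟶ 𝓤.Ut) where
  toFun o := 𝓤.uTilde₁Fun Γ o
  invFun g := 𝓤.mkSec₁ Γ g
  left_inv o := by
    obtain ⟨g, rfl⟩ := exists_mkSec₁ o
    exact congrArg (𝓤.mkSec₁ Γ) (𝓤.uTilde₁Fun_mkSec₁ Γ g)
  right_inv g := 𝓤.uTilde₁Fun_mkSec₁ Γ g

/-- The function `T ↦ (u₁(ft T), u₁(T))` on `Ob_2(Γ)`. -/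
noncomputable def u₂Fun (Γ : 𝓤.CC) (T : 𝓤.cSystem.ObOver 2 Γ) : 𝓤.D Γ.int 𝓤.U :=
  ⟨𝓤.u₁ Γ T.ft, eqToHom (𝓤.int_eq_ext T.ft).symm ≫ 𝓤.u₁ T.ft.1 T.top⟩

theorem u₂Fun_mkOb₂ (Γ : 𝓤.CC) (d : 𝓤.D Γ.int 𝓤.U) : 𝓤.u₂Fun Γ (𝓤.mkOb₂ Γ d) = d := by
  obtain ⟨F₁, F₂⟩ := d
  refine 𝓤.D_ext _ _ (𝓤.u₁_mkOb₁ Γ F₁) fun e => ?_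
  exact congrArg (fun t => eqToHom e ≫ t) (𝓤.u₁_mkOb₁ (Γ.cons F₁) F₂)

/-- The bijection `u_{2,Γ} : Ob_2(Γ) → D_p(int Γ, U)`. -/
noncomputable def u₂ (Γ : 𝓤.CC) : 𝓤.cSystem.ObOver 2 Γ ≃ 𝓤.D Γ.int 𝓤.U where
  toFun T := 𝓤.u₂Fun Γ T
  invFun d := 𝓤.mkOb₂ Γ d
  left_inv T := by
    obtain ⟨d, rfl⟩ := exists_mkOb₂ T
    exact congrArg (𝓤.mkOb₂ Γ) (𝓤.u₂Fun_mkOb₂ Γ d)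
  right_inv d := 𝓤.u₂Fun_mkOb₂ Γ d

/-- The function sending a section `o` over `Ob_2(Γ)` to the pair of `u₁(ft(∂ o))` and the morphism
defined by `o` as a section over `Ob_1(ft(∂ o))`. -/
noncomputable def uTilde₂Fun (Γ : 𝓤.CC) (o : 𝓤.cSystem.SecOver 2 Γ) : 𝓤.D Γ.int 𝓤.Ut :=
  ⟨𝓤.u₁ Γ (𝓤.cSystem.bd o).ft,
    eqToHom (𝓤.int_eq_ext (𝓤.cSystem.bd o).ft).symm ≫ 𝓤.uTilde₁ (𝓤.cSystem.bd o).ft.1 o.top⟩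

theorem uTilde₂Fun_mkSec₂ (Γ : 𝓤.CC) (d : 𝓤.D Γ.int 𝓤.Ut) :
    𝓤.uTilde₂Fun Γ (𝓤.mkSec₂ Γ d) = d := by
  obtain ⟨F, g⟩ := d
  refine 𝓤.D_ext _ _ (𝓤.u₁_mkOb₁ Γ F) fun e => ?_
  exact congrArg (fun t => eqToHom e ≫ t) (𝓤.uTilde₁Fun_mkSec₁ (Γ.cons F) g)

/-- The bijection from the set of sections over `Ob_2(Γ)` to `D_p(int Γ, Ut)`. -/
noncomputable def uTilde₂ (Γ : 𝓤.CC) : 𝓤.cSystem.SecOver 2 Γ ≃ 𝓤.D Γ.int 𝓤.Ut where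
  toFun o := 𝓤.uTilde₂Fun Γ o
  invFun d := 𝓤.mkSec₂ Γ d
  left_inv o := by
    obtain ⟨d, rfl⟩ := exists_mkSec₂ o
    exact congrArg (𝓤.mkSec₂ Γ) (𝓤.uTilde₂Fun_mkSec₂ Γ d)
  right_inv d := 𝓤.uTilde₂Fun_mkSec₂ Γ d

theorem pullOb_mkOb₁ {Γ Γ' : 𝓤.CC} (f : Γ' ⟶ Γ) (F : Γ.int ⟶ 𝓤.U) :
    𝓤.cSystem.pullOb f (𝓤.mkOb₁ Γ F) = 𝓤.mkOb₁ Γ' (f.int ≫ F) := by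
  apply Subtype.ext
  have h : ∀ k : Γ' ⟶ Γ, k = f → Γ'.cons (k.int ≫ F) = Γ'.cons (f.int ≫ F) := by
    rintro k rfl
    rfl
  exact h (f ≫ 𝟙 Γ) (Category.comp_id f)

theorem pullOb_mkOb₂ {Γ Γ' : 𝓤.CC} (f : Γ' ⟶ Γ) (d : 𝓤.D Γ.int 𝓤.U) :
    𝓤.cSystem.pullOb f (𝓤.mkOb₂ Γ d) = 𝓤.mkOb₂ Γ' (𝓤.Dpre f.int 𝓤.U d) := by
  apply Subtype.ext
  have h : ∀ k : Γ' ⟶ Γ, k = f → (Γ'.cons (k.int ≫ d.1)).cons (𝓤.Qmap k.int d.1 ≫ d.2) =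
      (Γ'.cons (f.int ≫ d.1)).cons (𝓤.Qmap f.int d.1 ≫ d.2) := by
    rintro k rfl
    rfl
  exact h (f ≫ 𝟙 Γ) (Category.comp_id f)

theorem pull_mkSec {Γ Γ' : 𝓤.CC} (k : Γ' ⟶ Γ) (g : Γ.int ⟶ 𝓤.Ut) :
    CSystem.Sec.pull 𝓤.cSystem (𝓤.mkSec Γ (g ≫ 𝓤.p) g rfl) k =
      𝓤.mkSec Γ' ((k.int ≫ g) ≫ 𝓤.p) (k.int ≫ g) rfl := by
  have h : ∀ (G : Γ'.int ⟶ 𝓤.U) (e : (k.int ≫ g) ≫ 𝓤.p = G), G = k.int ≫ g ≫ 𝓤.p →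
      CSystem.Sec.pull 𝓤.cSystem (𝓤.mkSec Γ (g ≫ 𝓤.p) g rfl) k = 𝓤.mkSec Γ' G (k.int ≫ g) e := by
    rintro G e rfl
    set s := 𝓤.mkSec Γ (g ≫ 𝓤.p) g rfl with hs
    have h0 : (k ≫ s.hom) ≫ 𝓤.cSystem.p s.obj = 𝟙 Γ' ≫ k :=
      (Category.assoc k s.hom _).trans ((congrArg (fun t => k ≫ t) s.w).trans
        ((Category.comp_id k).trans (Category.id_comp k).symm))
    have h1 := (𝓤.cSystem.isPullback s.obj s.pos k).lift_fst (k ≫ s.hom) (𝟙 Γ') h0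
    have h2 := (𝓤.cSystem.isPullback s.obj s.pos k).lift_snd (k ≫ s.hom) (𝟙 Γ') h0
    have h1' := congrArg CC.Hom.int h1
    have h2' := congrArg CC.Hom.int h2
    unfold CSystem.Sec.pull mkSec
    congr 1
    apply CC.hom_ext
    set m := (𝓤.cSystem.isPullback s.obj s.pos k).lift (k ≫ s.hom) (𝟙 Γ') h0
    have h3 : ∀ m' : Γ'.int ⟶ 𝓤.ext (k.int ≫ g ≫ 𝓤.p),
        m' ≫ 𝓤.Qmap k.int (g ≫ 𝓤.p) =
          k.int ≫ 𝓤.pair (g ≫ 𝓤.p) (𝟙 Γ.int) g (Category.id_comp _).symm →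
        m' ≫ 𝓤.proj (k.int ≫ g ≫ 𝓤.p) ≫ 𝟙 Γ'.int = 𝟙 Γ'.int →
        𝟙 Γ'.int ≫ m' = 𝓤.pair (k.int ≫ g ≫ 𝓤.p) (𝟙 Γ'.int) (k.int ≫ g) (by simp) := by
      intro m' a b
      rw [Category.id_comp]
      refine 𝓤.hom_ext ?_ ?_
      · rw [pair_proj]
        rw [Category.comp_id] at b
        exact b
      · rw [pair_Q, ← Qmap_Q, ← Category.assoc, a, Category.assoc, pair_Q]
    exact h3 (CC.Hom.int m) h1' h2'
  exact h _ rfl (Category.assoc _ _ _)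

theorem pullSec_mkSec₁ {Γ Γ' : 𝓤.CC} (f : Γ' ⟶ Γ) (g : Γ.int ⟶ 𝓤.Ut) :
    𝓤.cSystem.pullSec f (𝓤.mkSec₁ Γ g) = 𝓤.mkSec₁ Γ' (f.int ≫ g) := by
  apply Subtype.ext
  have h : ∀ k : Γ' ⟶ Γ, k = f →
      CSystem.Sec.pull 𝓤.cSystem (𝓤.mkSec Γ (g ≫ 𝓤.p) g rfl) k =
        𝓤.mkSec Γ' ((f.int ≫ g) ≫ 𝓤.p) (f.int ≫ g) rfl := by
    rintro k rfl
    exact 𝓤.pull_mkSec k g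
  exact h (f ≫ 𝟙 Γ) (Category.comp_id f)

theorem pullSec_mkSec₂ {Γ Γ' : 𝓤.CC} (f : Γ' ⟶ Γ) (d : 𝓤.D Γ.int 𝓤.Ut) :
    𝓤.cSystem.pullSec f (𝓤.mkSec₂ Γ d) = 𝓤.mkSec₂ Γ' (𝓤.Dpre f.int 𝓤.Ut d) := by
  apply Subtype.ext
  have h : ∀ k : Γ' ⟶ Γ, k = f →
      CSystem.Sec.pull 𝓤.cSystem (𝓤.mkSec (Γ.cons d.1) (d.2 ≫ 𝓤.p) d.2 rfl)
        (⟨𝓤.Qmap k.int d.1⟩ : Γ'.cons (k.int ≫ d.1) ⟶ Γ.cons d.1) =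
      𝓤.mkSec (Γ'.cons (f.int ≫ d.1)) ((𝓤.Qmap f.int d.1 ≫ d.2) ≫ 𝓤.p)
        (𝓤.Qmap f.int d.1 ≫ d.2) rfl := by
    rintro k rfl
    exact 𝓤.pull_mkSec (⟨𝓤.Qmap k.int d.1⟩ : Γ'.cons (k.int ≫ d.1) ⟶ Γ.cons d.1) d.2
  exact h (f ≫ 𝟙 Γ) (Category.comp_id f)

theorem bd_mkSec₁ (Γ : 𝓤.CC) (g : Γ.int ⟶ 𝓤.Ut) :
    𝓤.cSystem.bd (𝓤.mkSec₁ Γ g) = 𝓤.mkOb₁ Γ (g ≫ 𝓤.p) := rfl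

theorem bd_mkSec₂ (Γ : 𝓤.CC) (d : 𝓤.D Γ.int 𝓤.Ut) :
    𝓤.cSystem.bd (𝓤.mkSec₂ Γ d) = 𝓤.mkOb₂ Γ (𝓤.Dpost _ 𝓤.p d) := rfl

end Bijections

section PiLambda

variable {C : Type u} [Category.{v} C] {𝓤 : UniverseCategory C} {L : LCCStructure C}
  (R : 𝓤.PiStructure L)

namespace PiStructure

/-- The function `Π_Γ(T) = u₁⁻¹(η(u₂(T)) ≫ P)`. -/
noncomputable def Pi {Γ : 𝓤.CC} (T : 𝓤.cSystem.ObOver 2 Γ) : 𝓤.cSystem.ObOver 1 Γ :=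
  (𝓤.u₁ Γ).symm (𝓤.eta L Γ.int 𝓤.U (𝓤.u₂ Γ T) ≫ R.P)

/-- The function `λ_Γ(s)`, defined in the same way by the bijections on sections and `Pt`. -/
noncomputable def lam {Γ : 𝓤.CC} (s : 𝓤.cSystem.SecOver 2 Γ) : 𝓤.cSystem.SecOver 1 Γ :=
  (𝓤.uTilde₁ Γ).symm (𝓤.eta L Γ.int 𝓤.Ut (𝓤.uTilde₂ Γ s) ≫ R.Pt)

theorem Pi_mkOb₂ {Γ : 𝓤.CC} (d : 𝓤.D Γ.int 𝓤.U) :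
    R.Pi (𝓤.mkOb₂ Γ d) = 𝓤.mkOb₁ Γ (𝓤.eta L Γ.int 𝓤.U d ≫ R.P) :=
  congrArg (fun t => 𝓤.mkOb₁ Γ (𝓤.eta L Γ.int 𝓤.U t ≫ R.P)) (𝓤.u₂Fun_mkOb₂ Γ d)

theorem lam_mkSec₂ {Γ : 𝓤.CC} (d : 𝓤.D Γ.int 𝓤.Ut) :
    R.lam (𝓤.mkSec₂ Γ d) = 𝓤.mkSec₁ Γ (𝓤.eta L Γ.int 𝓤.Ut d ≫ R.Pt) :=
  congrArg (fun t => 𝓤.mkSec₁ Γ (𝓤.eta L Γ.int 𝓤.Ut t ≫ R.Pt)) (𝓤.uTilde₂Fun_mkSec₂ Γ d)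

theorem eta_Dpost_comp_P {X : C} (d : 𝓤.D X 𝓤.Ut) :
    𝓤.eta L X 𝓤.U (𝓤.Dpost X 𝓤.p d) ≫ R.P = (𝓤.eta L X 𝓤.Ut d ≫ R.Pt) ≫ 𝓤.p := by
  rw [𝓤.eta_Dpost L, Category.assoc, Category.assoc, R.isPullback.w]

/-- The `(Π, λ)`-structure on `CC(C, p)` defined by a `Π`-structure on `p`. -/
noncomputable def piLambda : 𝓤.cSystem.PiLambda where
  Pi T := R.Pi T
  lam s := R.lam s
  bd_lam {Γ} s := by
    obtain ⟨d, rfl⟩ := exists_mkSec₂ s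
    rw [lam_mkSec₂, bd_mkSec₁, bd_mkSec₂, Pi_mkOb₂, eta_Dpost_comp_P]
  pull_Pi {Γ Γ'} f T := by
    obtain ⟨d, rfl⟩ := exists_mkOb₂ T
    rw [pullOb_mkOb₂, Pi_mkOb₂, Pi_mkOb₂, pullOb_mkOb₁, eta_Dpre, Category.assoc]
  pull_lam {Γ Γ'} f s := by
    obtain ⟨d, rfl⟩ := exists_mkSec₂ s
    rw [pullSec_mkSec₂, lam_mkSec₂, lam_mkSec₂, pullSec_mkSec₁, eta_Dpre, Category.assoc]
  existsUnique_lam {Γ} T t h := by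
    obtain ⟨d, rfl⟩ := exists_mkOb₂ T
    obtain ⟨g, rfl⟩ := exists_mkSec₁ t
    rw [bd_mkSec₁, Pi_mkOb₂] at h
    have h' : g ≫ 𝓤.p = 𝓤.eta L Γ.int 𝓤.U d ≫ R.P := (𝓤.u₁ Γ).symm.injective h
    refine ⟨𝓤.mkSec₂ Γ ((𝓤.eta L Γ.int 𝓤.Ut).symm
      (R.isPullback.lift g (𝓤.eta L Γ.int 𝓤.U d) h')), ⟨?_, ?_⟩, ?_⟩
    · rw [bd_mkSec₂]
      congr 1
      apply (𝓤.eta L Γ.int 𝓤.U).injective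
      rw [eta_Dpost, Equiv.apply_symm_apply, R.isPullback.lift_snd]
    · rw [lam_mkSec₂, Equiv.apply_symm_apply, R.isPullback.lift_fst]
    · rintro s ⟨hs, hs'⟩
      obtain ⟨e, rfl⟩ := exists_mkSec₂ s
      congr 1
      rw [Equiv.eq_symm_apply]
      rw [lam_mkSec₂] at hs'
      rw [bd_mkSec₂] at hs
      have hs1 : 𝓤.Dpost _ 𝓤.p e = d := (𝓤.u₂ Γ).symm.injective hs
      have hs2 : 𝓤.eta L Γ.int 𝓤.Ut e ≫ R.Pt = g := (𝓤.uTilde₁ Γ).symm.injective hs'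
      refine R.isPullback.hom_ext ?_ ?_
      · rw [R.isPullback.lift_fst, hs2]
      · rw [R.isPullback.lift_snd, ← eta_Dpost, hs1]

end PiStructure

end PiLambda

end UniverseCategory

/-- A functor of universe categories: a functor `Φ` with morphisms `φ : Φ(U) ⟶ U'` and
`φt : Φ(Ut) ⟶ Ut'` such that `Φ` takes the final object to a final object and pull-back squares
based on `p` to pull-back squares, and such that the square formed by `φt`, `Φ(p)`, `p'` and `φ` is
a pull-back square. -/
structure UniverseFunctor {C : Type u} [Category.{v} C] {C' : Type u'} [Category.{v'} C']
    (𝓤 : UniverseCategory C) (𝓤' : UniverseCategory C') where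
  Φ : C ⥤ C'
  φ : Φ.obj 𝓤.U ⟶ 𝓤'.U
  φt : Φ.obj 𝓤.Ut ⟶ 𝓤'.Ut
  isTerminal : IsTerminal (Φ.obj 𝓤.pt)
  map_isPullback : ∀ {W X : C} {a : W ⟶ 𝓤.Ut} {b : W ⟶ X} {F : X ⟶ 𝓤.U},
    IsPullback a b 𝓤.p F → IsPullback (Φ.map a) (Φ.map b) (Φ.map 𝓤.p) (Φ.map F)
  isPullback : IsPullback φt (Φ.map 𝓤.p) 𝓤'.p φ

namespace UniverseFunctor

variable {C : Type u} [Category.{v} C] {C' : Type u'} [Category.{v'} C']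
  {𝓤 : UniverseCategory C} {𝓤' : UniverseCategory C'} (𝓕 : UniverseFunctor 𝓤 𝓤')

theorem isPullback_ext {X : C} (F : X ⟶ 𝓤.U) :
    IsPullback (𝓕.Φ.map (𝓤.Q F) ≫ 𝓕.φt) (𝓕.Φ.map (𝓤.proj F)) 𝓤'.p (𝓕.Φ.map F ≫ 𝓕.φ) :=
  (𝓕.map_isPullback (𝓤.isPullback F)).paste_horiz 𝓕.isPullback

/-- For an isomorphism `ψ : Y ⟶ Φ(X)`, a morphism `F : X ⟶ U` and `G = ψ ≫ Φ(F) ≫ φ`, the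
isomorphism `(Y;G) ⟶ Φ(X;F)` over `ψ` and over `Ut'`. -/
noncomputable def extIso {X : C} {Y : C'} (ψ : Y ≅ 𝓕.Φ.obj X) (F : X ⟶ 𝓤.U) (G : Y ⟶ 𝓤'.U)
    (hG : G = ψ.hom ≫ 𝓕.Φ.map F ≫ 𝓕.φ) : 𝓤'.ext G ≅ 𝓕.Φ.obj (𝓤.ext F) where
  hom := (𝓕.isPullback_ext F).lift (𝓤'.Q G) (𝓤'.proj G ≫ ψ.hom)
    (by rw [(𝓤'.isPullback G).w, Category.assoc, hG])
  inv := 𝓤'.pair G (𝓕.Φ.map (𝓤.proj F) ≫ ψ.inv) (𝓕.Φ.map (𝓤.Q F) ≫ 𝓕.φt)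
    (by rw [(𝓕.isPullback_ext F).w, Category.assoc, hG, ψ.inv_hom_id_assoc])
  hom_inv_id := 𝓤'.hom_ext
    (by rw [Category.assoc, 𝓤'.pair_proj, ← Category.assoc, (𝓕.isPullback_ext F).lift_snd,
          Category.assoc, ψ.hom_inv_id, Category.comp_id, Category.id_comp])
    (by rw [Category.assoc, 𝓤'.pair_Q, (𝓕.isPullback_ext F).lift_fst, Category.id_comp])
  inv_hom_id := (𝓕.isPullback_ext F).hom_ext
    (by rw [Category.assoc, (𝓕.isPullback_ext F).lift_fst, 𝓤'.pair_Q, Category.id_comp])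
    (by rw [Category.assoc, (𝓕.isPullback_ext F).lift_snd, ← Category.assoc, 𝓤'.pair_proj,
          Category.assoc, ψ.inv_hom_id, Category.comp_id, Category.id_comp])

theorem extIso_hom_Q {X : C} {Y : C'} (ψ : Y ≅ 𝓕.Φ.obj X) (F : X ⟶ 𝓤.U) (G : Y ⟶ 𝓤'.U)
    (hG : G = ψ.hom ≫ 𝓕.Φ.map F ≫ 𝓕.φ) :
    (𝓕.extIso ψ F G hG).hom ≫ 𝓕.Φ.map (𝓤.Q F) ≫ 𝓕.φt = 𝓤'.Q G :=
  (𝓕.isPullback_ext F).lift_fst _ _ _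

theorem extIso_hom_proj {X : C} {Y : C'} (ψ : Y ≅ 𝓕.Φ.obj X) (F : X ⟶ 𝓤.U) (G : Y ⟶ 𝓤'.U)
    (hG : G = ψ.hom ≫ 𝓕.Φ.map F ≫ 𝓕.φ) :
    (𝓕.extIso ψ F G hG).hom ≫ 𝓕.Φ.map (𝓤.proj F) = 𝓤'.proj G ≫ ψ.hom :=
  (𝓕.isPullback_ext F).lift_snd _ _ _

/-- The canonical morphism `ι : (Φ(X); Φ(F) ≫ φ) ⟶ Φ(X;F)`. -/
noncomputable def iota {X : C} (F : X ⟶ 𝓤.U) :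
    𝓤'.ext (𝓕.Φ.map F ≫ 𝓕.φ) ⟶ 𝓕.Φ.obj (𝓤.ext F) :=
  (𝓕.isPullback_ext F).lift (𝓤'.Q _) (𝓤'.proj _) (𝓤'.isPullback _).w

/-- The function `D_p(X, V) → D_{p'}(Φ(X), Φ(V))`. -/
noncomputable def mapD {X V : C} (d : 𝓤.D X V) : 𝓤'.D (𝓕.Φ.obj X) (𝓕.Φ.obj V) :=
  ⟨𝓕.Φ.map d.1 ≫ 𝓕.φ, 𝓕.iota d.1 ≫ 𝓕.Φ.map d.2⟩

section LCC

variable (L : LCCStructure C) (L' : LCCStructure C')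

/-- The morphism `χ_Φ(V) : Φ(I_p(V)) ⟶ I_{p'}(Φ(V))`. -/
noncomputable def chi (V : C) : 𝓕.Φ.obj (𝓤.Ip L V) ⟶ 𝓤'.Ip L' (𝓕.Φ.obj V) :=
  𝓤'.eta L' _ _ (𝓕.mapD (𝓤.etaInv L _ V (𝟙 (𝓤.Ip L V))))

/-- The morphism `ξ_Φ : Φ(I_p(U)) ⟶ I_{p'}(U')`. -/
noncomputable def xi : 𝓕.Φ.obj (𝓤.Ip L 𝓤.U) ⟶ 𝓤'.Ip L' 𝓤'.U :=
  𝓕.chi L L' 𝓤.U ≫ 𝓤'.IpMap L' 𝓕.φ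

/-- The morphism from `Φ(I_p(Ut))` to `I_{p'}(Ut')` defined in the same way. -/
noncomputable def xiTilde : 𝓕.Φ.obj (𝓤.Ip L 𝓤.Ut) ⟶ 𝓤'.Ip L' 𝓤'.Ut :=
  𝓕.chi L L' 𝓤.Ut ≫ 𝓤'.IpMap L' 𝓕.φt

end LCC

section Hom

/-- The functions `H_n` together with the isomorphisms `ψ_n(A) : int'(H_n(A)) ⟶ Φ(int(A))`. -/
noncomputable def towerMap : (n : ℕ) → (A : (𝓤.tower n).1) →
    (A' : (𝓤'.tower n).1) × ((𝓤'.tower n).2 A' ≅ 𝓕.Φ.obj ((𝓤.tower n).2 A))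
  | 0, _ => ⟨PUnit.unit, 𝓤'.isTerminal.uniqueUpToIso 𝓕.isTerminal⟩
  | n + 1, A => ⟨⟨(towerMap n A.1).1, (towerMap n A.1).2.hom ≫ 𝓕.Φ.map A.2 ≫ 𝓕.φ⟩,
      𝓕.extIso (towerMap n A.1).2 A.2 _ rfl⟩

/-- The function `H` on objects. -/
noncomputable def objH (X : 𝓤.CC) : 𝓤'.CC := ⟨X.n, (𝓕.towerMap X.n X.A).1⟩

/-- The isomorphisms `ψ(X) : int'(H(X)) ⟶ Φ(int(X))`. -/
noncomputable def psi (X : 𝓤.CC) : (𝓕.objH X).int ≅ 𝓕.Φ.obj X.int := (𝓕.towerMap X.n X.A).2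

theorem objH_cons (X : 𝓤.CC) (F : X.int ⟶ 𝓤.U) :
    𝓕.objH (X.cons F) = (𝓕.objH X).cons ((𝓕.psi X).hom ≫ 𝓕.Φ.map F ≫ 𝓕.φ) := rfl

theorem psi_cons (X : 𝓤.CC) (F : X.int ⟶ 𝓤.U) :
    𝓕.psi (X.cons F) = 𝓕.extIso (𝓕.psi X) F _ rfl := rfl

/-- The functor underlying `H`: on morphisms, `H(f) = ψ(X) ≫ Φ(int f) ≫ ψ(Y)⁻¹`. -/
noncomputable def functorH : 𝓤.CC ⥤ 𝓤'.CC where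
  obj := 𝓕.objH
  map {X Y} f := ⟨(𝓕.psi X).hom ≫ 𝓕.Φ.map f.int ≫ (𝓕.psi Y).inv⟩
  map_id X := UniverseCategory.CC.hom_ext (by
    change (𝓕.psi X).hom ≫ 𝓕.Φ.map (𝟙 X.int) ≫ (𝓕.psi X).inv = 𝟙 _
    simp)
  map_comp {X Y Z} f g := UniverseCategory.CC.hom_ext (by
    change (𝓕.psi X).hom ≫ 𝓕.Φ.map (f.int ≫ g.int) ≫ (𝓕.psi Z).inv =
      ((𝓕.psi X).hom ≫ 𝓕.Φ.map f.int ≫ (𝓕.psi Y).inv) ≫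
        (𝓕.psi Y).hom ≫ 𝓕.Φ.map g.int ≫ (𝓕.psi Z).inv
    simp)

theorem functorH_map_int {X Y : 𝓤.CC} (f : X ⟶ Y) :
    (𝓕.functorH.map f).int = (𝓕.psi X).hom ≫ 𝓕.Φ.map f.int ≫ (𝓕.psi Y).inv := rfl

theorem pull_comp_top {X Y : C} {X' Y' : C'} (ψ : X' ≅ 𝓕.Φ.obj X) (ψ' : Y' ≅ 𝓕.Φ.obj Y)
    (F : X ⟶ 𝓤.U) (f : Y ⟶ X) :
    ψ'.hom ≫ 𝓕.Φ.map (f ≫ F) ≫ 𝓕.φ =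
      ((ψ'.hom ≫ 𝓕.Φ.map f ≫ ψ.inv) ≫ 𝟙 X') ≫ ψ.hom ≫ 𝓕.Φ.map F ≫ 𝓕.φ := by
  simp

theorem map_Qmap_comp_inv {X Y : C} {X' Y' : C'} (ψ : X' ≅ 𝓕.Φ.obj X) (ψ' : Y' ≅ 𝓕.Φ.obj Y)
    (F : X ⟶ 𝓤.U) (f : Y ⟶ X) (G : X' ⟶ 𝓤'.U) (hG : G = ψ.hom ≫ 𝓕.Φ.map F ≫ 𝓕.φ)
    (G' : Y' ⟶ 𝓤'.U) (hG' : G' = ψ'.hom ≫ 𝓕.Φ.map (f ≫ F) ≫ 𝓕.φ)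
    (k : Y' ⟶ X') (hk : k = (ψ'.hom ≫ 𝓕.Φ.map f ≫ ψ.inv) ≫ 𝟙 X')
    (e : 𝓤'.ext G' = 𝓤'.ext (k ≫ G)) :
    (𝓕.extIso ψ' (f ≫ F) G' hG').hom ≫ 𝓕.Φ.map (𝓤.Qmap f F) ≫ (𝓕.extIso ψ F G hG).inv =
      eqToHom e ≫ 𝓤'.Qmap k G := by
  have h0 : G' = k ≫ G := by
    rw [hG', hk, hG]
    exact 𝓕.pull_comp_top ψ ψ' F f
  rw [← Category.assoc, Iso.comp_inv_eq]
  refine (𝓕.isPullback_ext F).hom_ext ?_ ?_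
  · rw [Category.assoc, Category.assoc, Category.assoc, 𝓕.extIso_hom_Q, 𝓤'.Qmap_Q,
      𝓤'.eqToHom_Q h0, ← Category.assoc (𝓕.Φ.map _), ← 𝓕.Φ.map_comp, 𝓤.Qmap_Q, 𝓕.extIso_hom_Q]
  · have e3 : k ≫ ψ.hom = ψ'.hom ≫ 𝓕.Φ.map f := by
      rw [hk]
      simp
    have e4 : 𝓤'.Qmap k G ≫ 𝓤'.proj G ≫ ψ.hom = 𝓤'.proj (k ≫ G) ≫ ψ'.hom ≫ 𝓕.Φ.map f := by
      rw [← Category.assoc, 𝓤'.Qmap_proj, Category.assoc, e3]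
    rw [Category.assoc, Category.assoc, Category.assoc, 𝓕.extIso_hom_proj, e4,
      ← Category.assoc (eqToHom e), 𝓤'.eqToHom_proj h0, ← 𝓕.Φ.map_comp, 𝓤.Qmap_proj,
      𝓕.Φ.map_comp, ← Category.assoc, 𝓕.extIso_hom_proj, Category.assoc]

theorem map_proj_comp_inv {X : C} {Y : C'} (ψ : Y ≅ 𝓕.Φ.obj X) (F : X ⟶ 𝓤.U) (G : Y ⟶ 𝓤'.U)
    (hG : G = ψ.hom ≫ 𝓕.Φ.map F ≫ 𝓕.φ) :
    (𝓕.extIso ψ F G hG).hom ≫ 𝓕.Φ.map (𝓤.proj F) ≫ ψ.inv = 𝓤'.proj G ≫ 𝟙 Y := by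
  rw [← Category.assoc, 𝓕.extIso_hom_proj, Category.assoc, ψ.hom_inv_id]

/-- The homomorphism of C-systems `H : CC(C, p) → CC(C', p')` defined by a functor of universe
categories. -/
noncomputable def homH : CSystem.Hom 𝓤.cSystem 𝓤'.cSystem where
  toFunctor := 𝓕.functorH
  l_obj _ := rfl
  ft_obj X := by
    obtain ⟨n, A⟩ := X
    cases n <;> rfl
  map_p X := by
    obtain ⟨n, A⟩ := X
    cases n with
    | zero => exact (𝓕.functorH.map_id ⟨0, A⟩).trans (Category.comp_id _).symm
    | succ n =>
      apply UniverseCategory.CC.hom_ext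
      exact 𝓕.map_proj_comp_inv (𝓕.psi ⟨n, A.1⟩) A.2 _ rfl
  obj_pull X h Y f := by
    obtain ⟨X, F, rfl⟩ := X.exists_cons h
    exact UniverseCategory.CC.cons_congr rfl _ _ ((𝓕.pull_comp_top (𝓕.psi X) (𝓕.psi Y) F _).trans
      (Category.id_comp _).symm)
  map_q X h Y f := by
    obtain ⟨X, F, rfl⟩ := X.exists_cons h
    apply UniverseCategory.CC.hom_ext
    rw [UniverseCategory.CC.comp_int, UniverseCategory.CC.eqToHom_int]
    exact 𝓕.map_Qmap_comp_inv (𝓕.psi X) (𝓕.psi Y) F _ _ rfl _ rfl _ rfl _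

end Hom

end UniverseFunctor

/-!
Under the bijections `u₁`, `u₂`, `uTilde₁`, `uTilde₂` the functions `Π` and `λ` become
`d ↦ η(d) ≫ P` and `d ↦ η(d) ≫ Pt`, so the claim is about what `H` does on the other side of these
bijections and about how `η` interacts with `Φ`.

* On `Ob_1(Γ)` and on sections over it, `H` is `F ↦ ψ(Γ) ≫ Φ(F) ≫ φ` and `g ↦ ψ(Γ) ≫ Φ(g) ≫ φt`
  (`mapOb_mkOb₁`, `mapSec_mkSec₁`). On `Ob_2(Γ)` and on sections over it, `H` is `Φ²` followed by
  the action of `ψ(Γ)` and of `φ` or `φt` on `D_{p'}` (`mapOb_mkOb₂`, `mapSec_mkSec₂`).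
* Since `d = η^!(η(d))` is obtained from `η^!(Id)` by the action of `η(d)`, and `Φ²` is natural
  (`mapD_Dpre`), a Yoneda argument gives `η'(Φ²(d)) = Φ(η(d)) ≫ χ(V)` (`eta_mapD`).

Hence applying `η'` to `H` of an element with coordinate `d` gives `ψ(Γ) ≫ Φ(η(d)) ≫ ξ`, with the
morphism `ξ` or its analogue for `Ut` (`eta_Dpost_Dpre_mapD`), and the two hypotheses turn
composition with `P'` or `Pt'` into the coordinate of `H(Π(T))` or `H(λ(s))`.
-/

namespace UniverseCategory

variable {C : Type u} [Category.{v} C] (𝓤 : UniverseCategory C) (L : LCCStructure C)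

theorem Dpre_etaInv_id {X V : C} (g : X ⟶ 𝓤.Ip L V) :
    𝓤.Dpre g V (𝓤.etaInv L _ V (𝟙 (𝓤.Ip L V))) = 𝓤.etaInv L X V g := by
  apply (𝓤.eta L X V).injective
  rw [eta_Dpre, eta_etaInv, eta_etaInv, Category.comp_id]

variable {𝓤}

/-- A section of the canonical projection of `(Γ;F)` is determined by its composite with
`Q(F)`. -/
theorem eq_mkSec {Γ : 𝓤.CC} {F : Γ.int ⟶ 𝓤.U} (pos : 0 < 𝓤.cSystem.l (Γ.cons F))
    (s : 𝓤.cSystem.ft (Γ.cons F) ⟶ Γ.cons F) (w : s ≫ 𝓤.cSystem.p (Γ.cons F) = 𝟙 _)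
    (g : Γ.int ⟶ 𝓤.Ut) (hg : CC.Hom.int s ≫ 𝓤.Q F = g) :
    (⟨Γ.cons F, pos, s, w⟩ : 𝓤.cSystem.Sec) = 𝓤.mkSec Γ (g ≫ 𝓤.p) g rfl := by
  let s' : Γ.int ⟶ 𝓤.ext F := CC.Hom.int s
  have w' : s' ≫ 𝓤.proj F = 𝟙 Γ.int := congrArg CC.Hom.int w
  replace hg : s' ≫ 𝓤.Q F = g := hg
  have hF : g ≫ 𝓤.p = F := by
    rw [← hg, Category.assoc, (𝓤.isPullback F).w, ← Category.assoc, w', Category.id_comp]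
  subst hF
  unfold mkSec
  congr 1
  apply CC.hom_ext
  exact 𝓤.hom_ext (w'.trans (𝓤.pair_proj _ _ _ _).symm) (hg.trans (𝓤.pair_Q _ _ _ _).symm)

end UniverseCategory

namespace UniverseFunctor

open UniverseCategory

variable {C : Type u} [Category.{v} C] {C' : Type u'} [Category.{v'} C']
  {𝓤 : UniverseCategory C} {𝓤' : UniverseCategory C'} (𝓕 : UniverseFunctor 𝓤 𝓤')

theorem iota_Q {X : C} (F : X ⟶ 𝓤.U) :
    𝓕.iota F ≫ 𝓕.Φ.map (𝓤.Q F) ≫ 𝓕.φt = 𝓤'.Q (𝓕.Φ.map F ≫ 𝓕.φ) :=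
  (𝓕.isPullback_ext F).lift_fst _ _ _

theorem iota_proj {X : C} (F : X ⟶ 𝓤.U) :
    𝓕.iota F ≫ 𝓕.Φ.map (𝓤.proj F) = 𝓤'.proj (𝓕.Φ.map F ≫ 𝓕.φ) :=
  (𝓕.isPullback_ext F).lift_snd _ _ _

/-- `ι` is natural in the base object. -/
theorem iota_map_Qmap {X' X : C} (f : X' ⟶ X) (F : X ⟶ 𝓤.U)
    (e : 𝓤'.ext (𝓕.Φ.map (f ≫ F) ≫ 𝓕.φ) = 𝓤'.ext (𝓕.Φ.map f ≫ 𝓕.Φ.map F ≫ 𝓕.φ)) :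
    𝓕.iota (f ≫ F) ≫ 𝓕.Φ.map (𝓤.Qmap f F) =
      eqToHom e ≫ 𝓤'.Qmap (𝓕.Φ.map f) (𝓕.Φ.map F ≫ 𝓕.φ) ≫ 𝓕.iota F := by
  have h0 : 𝓕.Φ.map (f ≫ F) ≫ 𝓕.φ = 𝓕.Φ.map f ≫ 𝓕.Φ.map F ≫ 𝓕.φ := by
    rw [𝓕.Φ.map_comp, Category.assoc]
  refine (𝓕.isPullback_ext F).hom_ext ?_ ?_
  · simp only [Category.assoc]
    rw [iota_Q, Qmap_Q, 𝓤'.eqToHom_Q h0, ← 𝓕.Φ.map_comp_assoc, Qmap_Q, iota_Q]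
  · simp only [Category.assoc]
    rw [iota_proj, Qmap_proj, ← Category.assoc (eqToHom e), 𝓤'.eqToHom_proj h0,
      ← 𝓕.Φ.map_comp, Qmap_proj, 𝓕.Φ.map_comp (𝓤.proj _), ← Category.assoc, iota_proj]

/-- `Φ²` is natural in the first argument of `D_p`. -/
theorem mapD_Dpre {X' X V : C} (f : X' ⟶ X) (d : 𝓤.D X V) :
    𝓕.mapD (𝓤.Dpre f V d) = 𝓤'.Dpre (𝓕.Φ.map f) (𝓕.Φ.obj V) (𝓕.mapD d) := by
  refine 𝓤'.D_ext _ _ (by simp [Dpre, mapD]) fun e => ?_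
  have h := congrArg (· ≫ 𝓕.Φ.map d.2) (𝓕.iota_map_Qmap f d.1 e)
  simp only [Category.assoc] at h
  exact (congrArg (𝓕.iota (f ≫ d.1) ≫ ·) (𝓕.Φ.map_comp _ _)).trans h

/-- The isomorphism over `ψ` factors through the base change of `ψ`. -/
theorem extIso_hom_eq {X : C} {Y : C'} (ψ : Y ≅ 𝓕.Φ.obj X) (F : X ⟶ 𝓤.U) :
    (𝓕.extIso ψ F _ rfl).hom = 𝓤'.Qmap ψ.hom (𝓕.Φ.map F ≫ 𝓕.φ) ≫ 𝓕.iota F := by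
  refine (𝓕.isPullback_ext F).hom_ext ?_ ?_
  · rw [extIso_hom_Q, Category.assoc, iota_Q, Qmap_Q]
  · rw [extIso_hom_proj, Category.assoc, iota_proj, Qmap_proj]

section LCC

variable (L : LCCStructure C) (L' : LCCStructure C')

/-- `χ(V)` represents `Φ²` under `η` and `η'`. -/
theorem eta_mapD {X V : C} (d : 𝓤.D X V) :
    𝓤'.eta L' _ _ (𝓕.mapD d) = 𝓕.Φ.map (𝓤.eta L X V d) ≫ 𝓕.chi L L' V := by
  obtain ⟨g, rfl⟩ := (𝓤.etaInv_bijective L X V).2 d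
  rw [eta_etaInv, ← Dpre_etaInv_id, mapD_Dpre, eta_Dpre]
  rfl

theorem eta_Dpost_Dpre_mapD {X V : C} {Y V' : C'} (k : Y ⟶ 𝓕.Φ.obj X) (a : 𝓕.Φ.obj V ⟶ V')
    (d : 𝓤.D X V) :
    𝓤'.eta L' Y V' (𝓤'.Dpost Y a (𝓤'.Dpre k _ (𝓕.mapD d))) =
      k ≫ 𝓕.Φ.map (𝓤.eta L X V d) ≫ 𝓕.chi L L' V ≫ 𝓤'.IpMap L' a := by
  rw [eta_Dpost, eta_Dpre, 𝓕.eta_mapD L L', Category.assoc, Category.assoc]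

end LCC

theorem mapOb_mkOb₁ (Γ : 𝓤.CC) (F : Γ.int ⟶ 𝓤.U) :
    𝓕.homH.mapOb (𝓤.mkOb₁ Γ F) =
      𝓤'.mkOb₁ (𝓕.objH Γ) ((𝓕.psi Γ).hom ≫ 𝓕.Φ.map F ≫ 𝓕.φ) := rfl

theorem mapOb_mkOb₂ (Γ : 𝓤.CC) (d : 𝓤.D Γ.int 𝓤.U) :
    𝓕.homH.mapOb (𝓤.mkOb₂ Γ d) =
      𝓤'.mkOb₂ (𝓕.objH Γ) (𝓤'.Dpost _ 𝓕.φ (𝓤'.Dpre (𝓕.psi Γ).hom _ (𝓕.mapD d))) := by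
  apply Subtype.ext
  refine congrArg (CC.cons ((𝓕.objH Γ).cons ((𝓕.psi Γ).hom ≫ 𝓕.Φ.map d.1 ≫ 𝓕.φ))) ?_
  change (𝓕.extIso (𝓕.psi Γ) d.1 _ rfl).hom ≫ 𝓕.Φ.map d.2 ≫ 𝓕.φ =
    (𝓤'.Qmap (𝓕.psi Γ).hom (𝓕.Φ.map d.1 ≫ 𝓕.φ) ≫ 𝓕.iota d.1 ≫ 𝓕.Φ.map d.2) ≫ 𝓕.φ
  rw [extIso_hom_eq]
  simp only [Category.assoc]

theorem mapSec_mkSec {n : ℕ} {Γ₀ : 𝓤.CC} (Γ : 𝓤.CC) (g : Γ.int ⟶ 𝓤.Ut)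
    (h : 𝓤.cSystem.IsOver n Γ₀ (𝓤.mkSec Γ (g ≫ 𝓤.p) g rfl).obj) :
    (𝓕.homH.mapSec ⟨𝓤.mkSec Γ (g ≫ 𝓤.p) g rfl, h⟩).1 =
      𝓤'.mkSec (𝓕.objH Γ) (((𝓕.psi Γ).hom ≫ 𝓕.Φ.map g ≫ 𝓕.φt) ≫ 𝓤'.p)
        ((𝓕.psi Γ).hom ≫ 𝓕.Φ.map g ≫ 𝓕.φt) rfl := by
  let σ : Γ.int ⟶ 𝓤.ext (g ≫ 𝓤.p) := 𝓤.pair _ (𝟙 Γ.int) g (Category.id_comp _).symm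
  refine eq_mkSec (F := (𝓕.psi Γ).hom ≫ 𝓕.Φ.map (g ≫ 𝓤.p) ≫ 𝓕.φ) _ _ _ _ ?_
  change (𝟙 _ ≫ (𝓕.psi Γ).hom ≫ 𝓕.Φ.map σ ≫ (𝓕.extIso (𝓕.psi Γ) (g ≫ 𝓤.p) _ rfl).inv) ≫
    𝓤'.Q _ = (𝓕.psi Γ).hom ≫ 𝓕.Φ.map g ≫ 𝓕.φt
  rw [← 𝓕.extIso_hom_Q (𝓕.psi Γ) (g ≫ 𝓤.p) _ rfl]
  simp only [Category.assoc, Iso.inv_hom_id_assoc, Category.id_comp]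
  rw [← 𝓕.Φ.map_comp_assoc, pair_Q]

theorem mapSec_mkSec₁ (Γ : 𝓤.CC) (g : Γ.int ⟶ 𝓤.Ut) :
    𝓕.homH.mapSec (𝓤.mkSec₁ Γ g) =
      𝓤'.mkSec₁ (𝓕.objH Γ) ((𝓕.psi Γ).hom ≫ 𝓕.Φ.map g ≫ 𝓕.φt) :=
  Subtype.ext (𝓕.mapSec_mkSec Γ g _)

theorem mapSec_mkSec₂ (Γ : 𝓤.CC) (d : 𝓤.D Γ.int 𝓤.Ut) :
    𝓕.homH.mapSec (𝓤.mkSec₂ Γ d) =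
      𝓤'.mkSec₂ (𝓕.objH Γ) (𝓤'.Dpost _ 𝓕.φt (𝓤'.Dpre (𝓕.psi Γ).hom _ (𝓕.mapD d))) := by
  apply Subtype.ext
  refine (𝓕.mapSec_mkSec (Γ.cons d.1) d.2 _).trans ?_
  refine congrArg (fun t => 𝓤'.mkSec ((𝓕.objH Γ).cons ((𝓕.psi Γ).hom ≫ 𝓕.Φ.map d.1 ≫ 𝓕.φ))
    (t ≫ 𝓤'.p) t rfl) ?_
  change (𝓕.extIso (𝓕.psi Γ) d.1 _ rfl).hom ≫ 𝓕.Φ.map d.2 ≫ 𝓕.φt =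
    (𝓤'.Qmap (𝓕.psi Γ).hom (𝓕.Φ.map d.1 ≫ 𝓕.φ) ≫ 𝓕.iota d.1 ≫ 𝓕.Φ.map d.2) ≫ 𝓕.φt
  rw [extIso_hom_eq]
  simp only [Category.assoc]

end UniverseFunctor

theorem theorem2015p03p21 {C : Type u} [Category.{v} C] {C' : Type u'} [Category.{v'} C']
    (𝓤 : UniverseCategory C) (L : LCCStructure C)
    (𝓤' : UniverseCategory C') (L' : LCCStructure C')
    (𝓕 : UniverseFunctor 𝓤 𝓤')
    (R : 𝓤.PiStructure L) (R' : 𝓤'.PiStructure L')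
    (h : 𝓕.xi L L' ≫ R'.P = 𝓕.Φ.map R.P ≫ 𝓕.φ)
    (hTilde : 𝓕.xiTilde L L' ≫ R'.Pt = 𝓕.Φ.map R.Pt ≫ 𝓕.φt) :
    𝓕.homH.PreservesPiLambda R.piLambda R'.piLambda where
  map_Pi {Γ} T := by
    obtain ⟨d, rfl⟩ := UniverseCategory.exists_mkOb₂ T
    have e : (𝓕.psi Γ).hom ≫ 𝓕.Φ.map (𝓤.eta L Γ.int 𝓤.U d ≫ R.P) ≫ 𝓕.φ =
        𝓤'.eta L' _ _ (𝓤'.Dpost _ 𝓕.φ (𝓤'.Dpre (𝓕.psi Γ).hom _ (𝓕.mapD d))) ≫ R'.P := by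
      rw [𝓕.eta_Dpost_Dpre_mapD L L', 𝓕.Φ.map_comp, Category.assoc, ← h]
      simp only [UniverseFunctor.xi, Category.assoc]
    exact (congrArg 𝓕.homH.mapOb (R.Pi_mkOb₂ d)).trans <|
      (congrArg (𝓤'.mkOb₁ (𝓕.objH Γ)) e).trans <|
      (R'.Pi_mkOb₂ (Γ := 𝓕.objH Γ) _).symm.trans (congrArg R'.Pi (𝓕.mapOb_mkOb₂ Γ d).symm)
  map_lam {Γ} s := by
    obtain ⟨d, rfl⟩ := UniverseCategory.exists_mkSec₂ s
    have e : (𝓕.psi Γ).hom ≫ 𝓕.Φ.map (𝓤.eta L Γ.int 𝓤.Ut d ≫ R.Pt) ≫ 𝓕.φt =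
        𝓤'.eta L' _ _ (𝓤'.Dpost _ 𝓕.φt (𝓤'.Dpre (𝓕.psi Γ).hom _ (𝓕.mapD d))) ≫ R'.Pt := by
      rw [𝓕.eta_Dpost_Dpre_mapD L L', 𝓕.Φ.map_comp, Category.assoc, ← hTilde]
      simp only [UniverseFunctor.xiTilde, Category.assoc]
    exact (congrArg 𝓕.homH.mapSec (R.lam_mkSec₂ d)).trans <|
      (𝓕.mapSec_mkSec₁ Γ _).trans <| (congrArg (𝓤'.mkSec₁ (𝓕.objH Γ)) e).trans <|
      (R'.lam_mkSec₂ (Γ := 𝓕.objH Γ) _).symm.trans (congrArg R'.lam (𝓕.mapSec_mkSec₂ Γ d).symm)
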